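/- \textbf{Setting.} There are $N\ge 2$ buyers with unit demand whose values $X_1,\dots,X_N$ are drawn independently from a distribution $F$ with support $[\underline x,\bar x]$, $0\le\underline x<\bar x$, and with a density $f$ that is continuous on $[\underline x,\bar x]$ and positive on $(\underline x,\bar x)$. The virtual value $\psi(x)=x-\frac{1-F(x)}{f(x)}$ is assumed to be strictly increasing on $(\underline x,\bar x)$ and to have a zero $\psi^{-1}(0)\in[\underline x,\bar x)$ (with $f(\psi^{-1}(0))>0$). For a profile $\mathbf x$ let $x_{(1)}\ge x_{(2)}\ge\dots$ be its entries in decreasing order (if $N=2$, put $x_{(3)}=0$). Two sellers, each with one unit of the same good, sell in sequence. The second seller uses a second-price auction with reserve price $r$, in which every buyer who did not obtain the first unit bids his value. The first seller chooses a direct mechanism $(P,t)$: given the reports $\mathbf x\in[\underline x,\bar x]^N$, buyer $i$ gets the first unit with probability $P_i(\mathbf x)\ge 0$, where $\sum_i P_i(\mathbf x)\le 1$, and makes the expected payment $t_i(\mathbf x)$. The functions $P_i,t_i$ are measurable and, for each report of buyer $i$, his payment is integrable over the others' values. A buyer of value $v$ gets gross payoff $v$ if he obtains the first unit, and $\max\{v-\max\{r,y\},0\}$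 otherwise, where $y$ is the highest value among the rivals who take part in the second auction (the term $y$ is dropped if there are none). The mechanism is incentive compatible if, when the others report truthfully, truthful reporting maximizes the interim expected payoff of every type $v\in[\underline x,\bar x]$ of every buyer; it is individually rational if every type of every buyer gets at least the expected payoff that he would have in the second auction if the first unit were allocated to nobody. It is optimal if it is incentive compatible and individually rational and if its expected revenue $\sum_i E[t_i(\mathbf X)]$ (computed as the expectation of the buyers' interim expected payments) is the largest among all incentive compatible and individually rational direct mechanisms, symmetric or not. \textbf{Theorem.} Let $r\in[\psi^{-1}(0),\bar x)$. Then the following direct mechanism is optimal for the first seller (ties are broken uniformly at random). 1. Allocation rule: the good is allocated if and only if $\psi(x_{(1)})\ge 0$. In that case it goes to the bidder with the highest value if $x_{(2)}<r$; if $x_{(2)}\ge r$, it goes to either the bidder with the highest or the bidder with the second-highest value, where the choice between these two may be made by any rule, that is, in favour of the highest bidder with probability $w(\mathbf x)$ for an arbitrary measurable $w:[\underline x,\bar x]^N\to[0,1]$. 2. Transfers: (a) if $\psi(x_{(1)})\ge 0$ and $x_{(2)}<r$, the bidder with the highest value pays $\max\{\psi^{-1}(0),x_{(2)}\}$ and the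 others pay nothing; (b) if $x_{(2)}\ge r$, the bidder who receives the good pays $\max\{r,x_{(3)}\}$ and the others pay nothing; (c) if the good is not allocated, nobody pays. -/

import Mathlib

open MeasureTheory

noncomputable section

namespace SequentialAuction

/-- The virtual valuation `ψ(x) = x - (1 - F(x)) / f(x)` of a value distribution `μ` with
distribution function `F` and density `f`. -/
def virtualValue (μ : Measure ℝ) (f : ℝ → ℝ) (x : ℝ) : ℝ :=
  x - (1 - ProbabilityTheory.cdf μ x) / f x

/-- The `k`-th highest entry `x₍ₖ₎` of the profile `x` (`k = 1, …, N`, counted with multiplicity):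
the largest `v` such that at least `k` entries are `≥ v`.  If there are fewer than `k` bidders the
set is empty and the value is `0`. -/
def orderStat {N : ℕ} (k : ℕ) (x : Fin N → ℝ) : ℝ :=
  sSup {v : ℝ | k ≤ (Finset.univ.filter fun i => v ≤ x i).card}

/-- The surplus, in a second-price auction with reserve price `r` and truthful bidding, of a buyer
of value `v` who competes with the set `S` of rivals, whose values are given by `x`:
`max {v - max {r, max_{k ∈ S} x_k}, 0}`. -/
def secondPriceSurplus {N : ℕ} (r v : ℝ) (S : Finset (Fin N)) (x : Fin N → ℝ) : ℝ :=
  max (v - S.fold max r x) 0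

/-- A direct mechanism of the first seller: for a profile `x` of reports, `alloc x i` is the
probability that buyer `i` gets the first good and `pay x i` is buyer `i`'s (expected) payment. -/
structure DirectMechanism (N : ℕ) where
  alloc : (Fin N → ℝ) → Fin N → ℝ
  pay : (Fin N → ℝ) → Fin N → ℝ

/-- Payoff of buyer `i` with true value `v`, gross of the payment to the first seller, when the
reports are `x` and the rivals' reports are their true values.  If `i` gets the first good he gets
`v`; if rival `j` gets it, `i` meets all rivals but `j` in the second auction; if nobody gets it,
`i` meets all rivals there. -/
def grossPayoff {N : ℕ} (r : ℝ) (P : (Fin N → ℝ) → Fin N → ℝ) (i : Fin N) (v : ℝ)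
    (x : Fin N → ℝ) : ℝ :=
  P x i * v
    + ∑ j ∈ Finset.univ.erase i,
        P x j * secondPriceSurplus r v ((Finset.univ.erase i).erase j) x
    + (1 - ∑ j, P x j) * secondPriceSurplus r v (Finset.univ.erase i) x

/-- Expectation of `g` at the report profile in which buyer `i` reports `q` and the reports of the
others are independent draws from `μ`. -/
def interim {N : ℕ} (μ : Measure ℝ) (i : Fin N) (q : ℝ) (g : (Fin N → ℝ) → ℝ) : ℝ :=
  ∫ x, g (Function.update x i q) ∂(Measure.pi fun _ : Fin N => μ)

/-- `Π_i(q | v)`: expected gross payoff of buyer `i` of value `v` who reports `q`. -/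
def interimGross {N : ℕ} (μ : Measure ℝ) (r : ℝ) (M : DirectMechanism N) (i : Fin N)
    (q v : ℝ) : ℝ :=
  interim μ i q (grossPayoff r M.alloc i v)

/-- `t_i(q)`: expected payment of buyer `i` when he reports `q`. -/
def interimPay {N : ℕ} (μ : Measure ℝ) (M : DirectMechanism N) (i : Fin N) (q : ℝ) : ℝ :=
  interim μ i q fun x => M.pay x i

/-- Expected payoff of buyer `i` of value `v` if the first good is allocated to nobody. -/
def outsideOption {N : ℕ} (μ : Measure ℝ) (r : ℝ) (i : Fin N) (v : ℝ) : ℝ :=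
  interim μ i v (secondPriceSurplus r v (Finset.univ.erase i))

/-- Well-formed direct mechanisms on the type space `[lo, hi]^N`: allocation probabilities are
nonnegative and sum to at most one, and the expected payment of each report is well defined. -/
structure IsMechanism {N : ℕ} (μ : Measure ℝ) (lo hi : ℝ) (M : DirectMechanism N) : Prop where
  measurable_alloc : ∀ i, Measurable fun x => M.alloc x i
  measurable_pay : ∀ i, Measurable fun x => M.pay x i
  alloc_nonneg : ∀ x, (∀ j, x j ∈ Set.Icc lo hi) → ∀ i, 0 ≤ M.alloc x i
  sum_alloc_le : ∀ x, (∀ j, x j ∈ Set.Icc lo hi) → ∑ i, M.alloc x i ≤ 1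
  integrable_pay : ∀ i, ∀ q ∈ Set.Icc lo hi,
    Integrable (fun x => M.pay (Function.update x i q) i) (Measure.pi fun _ : Fin N => μ)

/-- (Bayesian) incentive compatibility: truthful reporting is a best response for every type. -/
def IncentiveCompatible {N : ℕ} (μ : Measure ℝ) (lo hi r : ℝ) (M : DirectMechanism N) : Prop :=
  ∀ i, ∀ v ∈ Set.Icc lo hi, ∀ q ∈ Set.Icc lo hi,
    interimGross μ r M i q v - interimPay μ M i q ≤
      interimGross μ r M i v v - interimPay μ M i v

/-- Individual rationality: every type gets at least his payoff from the second auction when the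
first good is allocated to nobody. -/
def IndividuallyRational {N : ℕ} (μ : Measure ℝ) (lo hi r : ℝ) (M : DirectMechanism N) : Prop :=
  ∀ i, ∀ v ∈ Set.Icc lo hi,
    outsideOption μ r i v ≤ interimGross μ r M i v v - interimPay μ M i v

/-- Well-formed, incentive compatible and individually rational direct mechanisms. -/
structure IsFeasible {N : ℕ} (μ : Measure ℝ) (lo hi r : ℝ) (M : DirectMechanism N) : Prop where
  isMechanism : IsMechanism μ lo hi M
  incentiveCompatible : IncentiveCompatible μ lo hi r M
  individuallyRational : IndividuallyRational μ lo hi r M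

/-- Expected revenue of the first seller under truthful reporting, `∑ᵢ E[t_i(X_i)]`. -/
def revenue {N : ℕ} (μ : Measure ℝ) (M : DirectMechanism N) : ℝ :=
  ∑ i, ∫ q, interimPay μ M i q ∂μ

/-- An optimal mechanism: feasible, with the largest expected revenue among all feasible ones. -/
def IsOptimal {N : ℕ} (μ : Measure ℝ) (lo hi r : ℝ) (M : DirectMechanism N) : Prop :=
  IsFeasible μ lo hi r M ∧ ∀ M' : DirectMechanism N, IsFeasible μ lo hi r M' →
    revenue μ M' ≤ revenue μ M

/-- Probability that buyer `i` is selected as the bidder with the `k`-th highest report, ties being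
broken uniformly at random. -/
def rankShare {N : ℕ} (k : ℕ) (x : Fin N → ℝ) (i : Fin N) : ℝ :=
  if x i = orderStat k x then
    1 / ((Finset.univ.filter fun j => x j = orderStat k x).card : ℝ) else 0

open Classical in
/-- The allocation rule: no allocation if `ψ(x₍₁₎) < 0`; otherwise to the highest bidder if
`x₍₂₎ < r`, and to the highest bidder with probability `w x` and the second-highest bidder with
probability `1 - w x` if `x₍₂₎ ≥ r`. -/
def candidateAlloc {N : ℕ} (ψ : ℝ → ℝ) (r : ℝ) (w : (Fin N → ℝ) → ℝ)
    (x : Fin N → ℝ) (i : Fin N) : ℝ :=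
  if 0 ≤ ψ (orderStat 1 x) then
    if orderStat 2 x < r then rankShare 1 x i
    else w x * rankShare 1 x i + (1 - w x) * rankShare 2 x i
  else 0

open Classical in
/-- The mechanism with this allocation rule in which only the buyer who receives the good pays:
`max {z, x₍₂₎}` if `x₍₂₎ < r` and `max {r, x₍₃₎}` if `x₍₂₎ ≥ r`. -/
def candidate {N : ℕ} (ψ : ℝ → ℝ) (z r : ℝ) (w : (Fin N → ℝ) → ℝ) : DirectMechanism N where
  alloc := candidateAlloc ψ r w
  pay x i := candidateAlloc ψ r w x i *
    (if orderStat 2 x < r then max z (orderStat 2 x) else max r (orderStat 3 x))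

end SequentialAuction

end

/-!
Given who receives the first unit, a buyer of value `v` gets the positive part of `v` minus a
*residual price* that depends only on the values of his rivals.  His payoff is therefore convex in
`v` with slope the probability of ending up with one of the two units, and under incentive
compatibility the envelope theorem gives: revenue is the expected total virtual surplus minus the
payoffs of the lowest types, where each buyer who gets a unit adds to the virtual surplus his
virtual value less what he pays to the second seller.  Individual rationality makes the payoffs of
the lowest types nonnegative.

Almost surely there are no ties, and then every outcome that the candidate allocation reaches
maximizes the total virtual surplus: once `x₍₂₎ ≥ r`, the two highest bidders get the two units
whichever of them wins the first, and the second seller receives `max {r, x₍₃₎}` either way.  The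
candidate transfers charge each buyer a price set by his rivals, the lowest at which he could obtain
a unit from either seller.  No report secures more than the positive part of his value minus this
price and the truth secures exactly that, so the candidate is incentive compatible and individually
rational; as the price is at least `z`, the lowest types get zero.
-/

noncomputable section

namespace SequentialAuction

section Subgradient

variable {g U : ℝ → ℝ} {s : Set ℝ} {a b t : ℝ}

/-- `g t` is the slope of a line supporting `U` on `s` at `t`, for every `t ∈ s`. -/
def IsSubgradientOn (g U : ℝ → ℝ) (s : Set ℝ) : Prop :=
  ∀ t ∈ s, ∀ v ∈ s, U t + g t * (v - t) ≤ U v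

namespace IsSubgradientOn

lemma mono (h : IsSubgradientOn g U s) {s' : Set ℝ} (hs : s' ⊆ s) : IsSubgradientOn g U s' :=
  fun t ht v hv => h t (hs ht) v (hs hv)

lemma mul_sub_le (h : IsSubgradientOn g U s) {t v : ℝ} (ht : t ∈ s) (hv : v ∈ s) :
    g t * (v - t) ≤ U v - U t := by
  linarith [h t ht v hv]

lemma sub_le_mul (h : IsSubgradientOn g U s) {t v : ℝ} (ht : t ∈ s) (hv : v ∈ s) :
    U v - U t ≤ g v * (v - t) := by
  linarith [h v hv t ht]

lemma monotoneOn (h : IsSubgradientOn g U s) : MonotoneOn g s := fun t ht v hv htv => by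
  rcases htv.eq_or_lt with rfl | hlt
  · exact le_rfl
  · exact le_of_mul_le_mul_right ((h.mul_sub_le ht hv).trans (h.sub_le_mul ht hv))
      (sub_pos.2 hlt)

lemma abs_le_max (h : IsSubgradientOn g U (Set.Icc a b)) (ht : t ∈ Set.Icc a b) :
    |g t| ≤ max |g a| |g b| :=
  have hab := ht.1.trans ht.2
  abs_le_max_abs_abs (h.monotoneOn (Set.left_mem_Icc.2 hab) ht ht.1)
    (h.monotoneOn ht (Set.right_mem_Icc.2 hab) ht.2)

lemma lipschitzOnWith (h : IsSubgradientOn g U (Set.Icc a b)) :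
    LipschitzOnWith (max ‖g a‖₊ ‖g b‖₊) U (Set.Icc a b) := by
  refine LipschitzOnWith.of_dist_le_mul fun v hv t ht => ?_
  have hmul : ∀ u ∈ Set.Icc a b, |g u * (v - t)| ≤ max |g a| |g b| * |v - t| := fun u hu =>
    (abs_mul _ _).trans_le (mul_le_mul_of_nonneg_right (h.abs_le_max hu) (abs_nonneg _))
  exact abs_le.2 ⟨(abs_le.1 (hmul t ht)).1.trans (h.mul_sub_le ht hv),
    (h.sub_le_mul ht hv).trans (abs_le.1 (hmul v hv)).2⟩

lemma hasDerivAt (h : IsSubgradientOn g U s) (hs : s ∈ nhds t) (hg : ContinuousAt g t) :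
    HasDerivAt U (g t) t := by
  rw [hasDerivAt_iff_isLittleO, Asymptotics.isLittleO_iff]
  intro ε hε
  filter_upwards [hs, Metric.continuousAt_iff'.1 hg ε hε] with v hv hgv
  have hnonneg := h.mul_sub_le (mem_of_mem_nhds hs) hv
  have hle := h.sub_le_mul (mem_of_mem_nhds hs) hv
  calc ‖U v - U t - (v - t) • g t‖ = U v - U t - g t * (v - t) := by
        rw [smul_eq_mul, mul_comm, Real.norm_of_nonneg (sub_nonneg.2 hnonneg)]
    _ ≤ (g v - g t) * (v - t) := by linarith
    _ ≤ |g v - g t| * |v - t| := (le_abs_self _).trans_eq (abs_mul _ _)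
    _ ≤ ε * ‖v - t‖ := mul_le_mul_of_nonneg_right hgv.le (abs_nonneg _)

lemma integral_eq_sub (h : IsSubgradientOn g U (Set.Icc a b)) (hab : a ≤ b) :
    ∫ t in a..b, g t = U b - U a := by
  refine integral_eq_of_hasDerivAt_off_countable_of_le U g hab
    h.monotoneOn.countable_not_continuousWithinAt h.lipschitzOnWith.continuousOn
    (fun t ⟨ht, hcont⟩ => ?_)
    (MonotoneOn.intervalIntegrable (by simpa only [Set.uIcc_of_le hab] using h.monotoneOn))
  have hnhds := Icc_mem_nhds ht.1 ht.2
  have hgt : ContinuousWithinAt g (Set.Icc a b) t :=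
    by_contra fun hc => hcont ⟨Set.Ioo_subset_Icc_self ht, hc⟩
  exact h.hasDerivAt hnhds (hgt.continuousAt hnhds)

lemma integrableOn_Ioc (h : IsSubgradientOn g U (Set.Icc a b)) : IntegrableOn g (Set.Ioc a b) :=
  (h.monotoneOn.integrableOn_isCompact isCompact_Icc).mono_set Set.Ioc_subset_Icc_self

end IsSubgradientOn

end Subgradient

section Profiles

lemma ae_pi_forall {ι : Type*} [Fintype ι] {α : ι → Type*} [∀ j, MeasurableSpace (α j)]
    {μ : ∀ j, Measure (α j)} [∀ j, SigmaFinite (μ j)] {p : ∀ j, α j → Prop}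
    (hp : ∀ j, ∀ᵐ t ∂μ j, p j t) : ∀ᵐ x ∂Measure.pi μ, ∀ j, p j (x j) :=
  ae_all_iff.2 fun j => (Measure.quasiMeasurePreserving_eval μ j).ae (hp j)

variable {ι : Type*} [DecidableEq ι]

lemma measurePreserving_update [Fintype ι] {α : ι → Type*} [∀ j, MeasurableSpace (α j)]
    (μ : ∀ j, Measure (α j)) [∀ j, IsProbabilityMeasure (μ j)] (i : ι) :
    MeasurePreserving (fun p : α i × (∀ j, α j) => Function.update p.2 i p.1)
      ((μ i).prod (Measure.pi μ)) (Measure.pi μ) := by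
  have hm : Measurable fun p : α i × (∀ j, α j) => Function.update p.2 i p.1 :=
    measurable_update'.comp measurable_swap
  refine ⟨hm, (Measure.pi_eq fun s hs => ?_).symm⟩
  have hpre : (fun p : α i × (∀ j, α j) => Function.update p.2 i p.1) ⁻¹' Set.univ.pi s =
      s i ×ˢ Set.univ.pi (Function.update s i Set.univ) := by
    ext p
    simp only [Set.mem_preimage, Set.mem_univ_pi, Set.mem_prod]
    rw [Function.forall_update_iff p.2 (p := fun j t => t ∈ s j),
      Function.forall_update_iff s (p := fun j t => p.2 j ∈ t)]
    simp only [Set.mem_univ, true_and]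
  rw [Measure.map_apply hm (MeasurableSet.univ_pi hs), hpre, Measure.prod_prod, Measure.pi_pi,
    ← Finset.mul_prod_erase _ _ (Finset.mem_univ i),
    ← Finset.mul_prod_erase _ (fun j => μ j (s j)) (Finset.mem_univ i), Function.update_self,
    measure_univ, one_mul]
  congr 1
  exact Finset.prod_congr rfl fun j hj => by
    rw [Function.update_of_ne (Finset.ne_of_mem_erase hj)]

lemma injective_update {α : Type*} {x : ι → α} (hx : Function.Injective x) (i : ι) {q : α}
    (hq : ∀ j, x j ≠ q) : Function.Injective (Function.update x i q) := by
  intro j k hjk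
  by_cases hj : j = i <;> by_cases hk : k = i
  · rw [hj, hk]
  · rw [hj, Function.update_self, Function.update_of_ne hk] at hjk
    exact absurd hjk.symm (hq k)
  · rw [hk, Function.update_self, Function.update_of_ne hj] at hjk
    exact absurd hjk (hq j)
  · rw [Function.update_of_ne hk, Function.update_of_ne hj] at hjk
    exact hx hjk

end Profiles

section Iid

variable {ι α : Type*} [Fintype ι] [MeasurableSpace α] [MeasurableEq α] {μ : Measure α}
  [IsProbabilityMeasure μ] [NullSingletonClass μ]

lemma ae_pi_injective : ∀ᵐ x ∂(Measure.pi fun _ : ι => μ), Function.Injective x := by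
  classical
  have hne : ∀ i j : ι, i ≠ j → ∀ᵐ x ∂(Measure.pi fun _ : ι => μ), x i ≠ x j := fun i j hij => by
    have hS : MeasurableSet {x : ι → α | x i ≠ x j} :=
      (measurableSet_eq_fun (measurable_pi_apply i) (measurable_pi_apply j)).compl
    have hmp := measurePreserving_update (fun _ : ι => μ) i
    rw [← hmp.map_eq, ae_map_iff hmp.measurable.aemeasurable hS]
    refine (Measure.ae_prod_iff_ae_ae (hmp.measurable hS)).2 (.of_forall fun q => ?_)
    filter_upwards [ae_pi_forall fun _ => Measure.ae_ne μ q] with x hx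
    rw [Function.update_self, Function.update_of_ne hij.symm]
    exact (hx j).symm
  have hall : ∀ᵐ x ∂(Measure.pi fun _ : ι => μ), ∀ i j, i ≠ j → x i ≠ x j :=
    ae_all_iff.2 fun i => ae_all_iff.2 fun j => Filter.eventually_imp_distrib_left.2 (hne i j)
  filter_upwards [hall] with x hx i j hij
  exact by_contra fun h => hx i j h hij

lemma ae_pi_injective_update [DecidableEq ι] (i : ι) (q : α) :
    ∀ᵐ x ∂(Measure.pi fun _ : ι => μ), Function.Injective (Function.update x i q) := by
  filter_upwards [ae_pi_injective, ae_pi_forall fun _ => Measure.ae_ne μ q] with x hx hq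
  exact injective_update hx i hq

end Iid

section IntegrationByParts

variable {μ : Measure ℝ} [IsProbabilityMeasure μ] {g : ℝ → ℝ} {lo hi : ℝ}

lemma integrable_uncurry_indicator_Iio (hg : IntegrableOn g (Set.Ioc lo hi)) :
    Integrable (Function.uncurry fun v s => (Set.Iio v).indicator g s)
      (μ.prod (volume.restrict (Set.Ioc lo hi))) :=
  (hg.comp_snd μ).indicator (measurableSet_lt measurable_snd measurable_fst)

lemma setIntegral_indicator_Iio {v : ℝ} (hv : v ∈ Set.Icc lo hi) :
    ∫ s in Set.Ioc lo hi, (Set.Iio v).indicator g s = ∫ s in lo..v, g s := by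
  have hset : Set.Ioo lo hi ∩ Set.Iio v = Set.Ioo lo v := by
    rw [Set.Ioo_inter_Iio, min_eq_right hv.2]
  rw [intervalIntegral.integral_of_le hv.1, integral_Ioc_eq_integral_Ioo,
    setIntegral_indicator measurableSet_Iio, hset, integral_Ioc_eq_integral_Ioo]

lemma integrable_integral_lower (hbox : ∀ᵐ v ∂μ, v ∈ Set.Icc lo hi)
    (hg : IntegrableOn g (Set.Ioc lo hi)) : Integrable (fun v => ∫ s in lo..v, g s) μ :=
  (integrable_uncurry_indicator_Iio hg).integral_prod_left.congr
    (hbox.mono fun _ hv => setIntegral_indicator_Iio hv)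

lemma integral_integral_lower (hbox : ∀ᵐ v ∂μ, v ∈ Set.Icc lo hi)
    (hg : IntegrableOn g (Set.Ioc lo hi)) :
    ∫ v, (∫ s in lo..v, g s) ∂μ =
      ∫ s in Set.Ioc lo hi, (1 - ProbabilityTheory.cdf μ s) * g s := by
  have htail : ∀ s, ∫ v, (Set.Iio v).indicator g s ∂μ =
      (1 - ProbabilityTheory.cdf μ s) * g s := fun s => by
    calc ∫ v, (Set.Iio v).indicator g s ∂μ
        = ∫ v, (Set.Ioi s).indicator (fun _ => g s) v ∂μ := rfl
      _ = (1 - ProbabilityTheory.cdf μ s) * g s := by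
          rw [integral_indicator_const _ measurableSet_Ioi, ProbabilityTheory.cdf_eq_real,
            ← Set.compl_Iic, probReal_compl_eq_one_sub measurableSet_Iic, smul_eq_mul]
  calc ∫ v, (∫ s in lo..v, g s) ∂μ
      = ∫ v, (∫ s in Set.Ioc lo hi, (Set.Iio v).indicator g s) ∂μ :=
        integral_congr_ae (hbox.mono fun v hv => (setIntegral_indicator_Iio hv).symm)
    _ = ∫ s in Set.Ioc lo hi, (∫ v, (Set.Iio v).indicator g s ∂μ) :=
        integral_integral_swap (integrable_uncurry_indicator_Iio hg)
    _ = ∫ s in Set.Ioc lo hi, (1 - ProbabilityTheory.cdf μ s) * g s := by simp only [htail]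

end IntegrationByParts

section Density

variable {μ : Measure ℝ} {f : ℝ → ℝ} {lo hi t : ℝ}

/-- `μ` has a density `f` that is positive on `(lo, hi)` and vanishes outside `[lo, hi]`. -/
structure IsDensityOn (μ : Measure ℝ) (f : ℝ → ℝ) (lo hi : ℝ) : Prop where
  measurable : Measurable f
  pos : ∀ x ∈ Set.Ioo lo hi, 0 < f x
  eq_zero : ∀ x, x ∉ Set.Icc lo hi → f x = 0
  eq_withDensity : μ = volume.withDensity fun x => ENNReal.ofReal (f x)

/-- The inverse hazard rate `(1 - F) / f`, the amount by which the virtual value falls short of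
the value. -/
def inverseHazard (μ : Measure ℝ) (f : ℝ → ℝ) (x : ℝ) : ℝ :=
  (1 - ProbabilityTheory.cdf μ x) / f x

lemma sub_virtualValue (μ : Measure ℝ) (f : ℝ → ℝ) (x : ℝ) :
    x - virtualValue μ f x = inverseHazard μ f x :=
  sub_sub_cancel _ _

lemma measurable_inverseHazard (hf : Measurable f) : Measurable (inverseHazard μ f) :=
  (measurable_const.sub (ProbabilityTheory.monotone_cdf μ).measurable).div hf

lemma measurable_virtualValue (hf : Measurable f) : Measurable (virtualValue μ f) :=
  measurable_id.sub (measurable_inverseHazard hf)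

lemma measurable_of_continuousOn_Icc (hf_cont : ContinuousOn f (Set.Icc lo hi))
    (hf_zero : ∀ x, x ∉ Set.Icc lo hi → f x = 0) : Measurable f := by
  classical
  have hf : (Set.Icc lo hi).piecewise f 0 = f := by
    rw [Set.piecewise_eq_indicator, Set.indicator_eq_self, Function.support_subset_iff']
    exact hf_zero
  rw [← hf]
  exact hf_cont.measurable_piecewise continuousOn_const measurableSet_Icc

namespace IsDensityOn

lemma virtualValue_le (h : IsDensityOn μ f lo hi) (ht : t ∈ Set.Ioo lo hi) :
    virtualValue μ f t ≤ t :=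
  sub_le_self _ (div_nonneg (sub_nonneg.2 (ProbabilityTheory.cdf_le_one μ t)) (h.pos t ht).le)

lemma nullSingletonClass (h : IsDensityOn μ f lo hi) : NullSingletonClass μ := by
  rw [h.eq_withDensity]
  exact nullSingletonClass_withDensity _

lemma ae_mem_Icc (h : IsDensityOn μ f lo hi) : ∀ᵐ t ∂μ, t ∈ Set.Icc lo hi := by
  rw [h.eq_withDensity, ae_withDensity_iff h.measurable.ennreal_ofReal]
  refine .of_forall fun t ht => by_contra fun hc => ht ?_
  rw [h.eq_zero t hc, ENNReal.ofReal_zero]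

lemma ae_mem_Ioo (h : IsDensityOn μ f lo hi) : ∀ᵐ t ∂μ, t ∈ Set.Ioo lo hi := by
  have := h.nullSingletonClass
  filter_upwards [h.ae_mem_Icc, μ.ae_ne lo, μ.ae_ne hi] with t ht hlo hhi
  exact ⟨ht.1.lt_of_ne' hlo, ht.2.lt_of_ne hhi⟩

lemma toReal_smul_inverseHazard_ae_eq (h : IsDensityOn μ f lo hi) (k : ℝ → ℝ) :
    (fun s => (ENNReal.ofReal (f s)).toReal • (inverseHazard μ f s * k s)) =ᵐ[volume]
      (Set.Ioc lo hi).indicator fun s => (1 - ProbabilityTheory.cdf μ s) * k s := by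
  filter_upwards [Measure.ae_ne volume lo, Measure.ae_ne volume hi] with s hslo hshi
  by_cases hs : s ∈ Set.Icc lo hi
  · have hs' : s ∈ Set.Ioo lo hi := ⟨hs.1.lt_of_ne' hslo, hs.2.lt_of_ne hshi⟩
    have hpos := h.pos s hs'
    rw [Set.indicator_of_mem (Set.Ioo_subset_Ioc_self hs'), ENNReal.toReal_ofReal hpos.le,
      inverseHazard, smul_eq_mul, ← mul_assoc, mul_div_cancel₀ _ hpos.ne']
  · rw [Set.indicator_of_notMem fun hc => hs (Set.Ioc_subset_Icc_self hc), h.eq_zero s hs,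
      ENNReal.ofReal_zero, ENNReal.toReal_zero, zero_smul]

lemma integral_inverseHazard_mul (h : IsDensityOn μ f lo hi) (k : ℝ → ℝ) :
    ∫ s, inverseHazard μ f s * k s ∂μ =
      ∫ s in Set.Ioc lo hi, (1 - ProbabilityTheory.cdf μ s) * k s := by
  calc ∫ s, inverseHazard μ f s * k s ∂μ
      = ∫ s, inverseHazard μ f s * k s ∂volume.withDensity fun x => ENNReal.ofReal (f x) :=
        congrArg (fun ν => ∫ s, inverseHazard μ f s * k s ∂ν) h.eq_withDensity
    _ = ∫ s, (ENNReal.ofReal (f s)).toReal • (inverseHazard μ f s * k s) :=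
        integral_withDensity_eq_integral_toReal_smul h.measurable.ennreal_ofReal
          (.of_forall fun _ => ENNReal.ofReal_lt_top) _
    _ = ∫ s in Set.Ioc lo hi, (1 - ProbabilityTheory.cdf μ s) * k s := by
        rw [integral_congr_ae (h.toReal_smul_inverseHazard_ae_eq k),
          integral_indicator measurableSet_Ioc]

lemma integrable_inverseHazard (h : IsDensityOn μ f lo hi) : Integrable (inverseHazard μ f) μ := by
  have hint : Integrable (fun s => inverseHazard μ f s * 1)
      (volume.withDensity fun x => ENNReal.ofReal (f x)) := by
    rw [integrable_withDensity_iff_integrable_smul' h.measurable.ennreal_ofReal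
      (.of_forall fun _ => ENNReal.ofReal_lt_top),
      integrable_congr (h.toReal_smul_inverseHazard_ae_eq _),
      integrable_indicator_iff measurableSet_Ioc]
    simp only [mul_one]
    refine Integrable.of_bound
      (measurable_const.sub (ProbabilityTheory.monotone_cdf μ).measurable).aestronglyMeasurable 1
      (.of_forall fun s => ?_)
    rw [Real.norm_of_nonneg (sub_nonneg.2 (ProbabilityTheory.cdf_le_one μ s))]
    exact sub_le_self _ (ProbabilityTheory.cdf_nonneg μ s)
  simpa only [mul_one, ← h.eq_withDensity] using hint

end IsDensityOn

end Density

open Finset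

section Outcomes

variable {ι : Type*} [Fintype ι] {p : ι → ℝ} {V : Option ι → ℝ} {c : ℝ}

/-- The law of the recipient of the first unit, given the buyers' winning probabilities `p`;
`none` stands for the event that the unit is not allocated. -/
def outcomeProb (p : ι → ℝ) : Option ι → ℝ
  | none => 1 - ∑ j, p j
  | some j => p j

lemma sum_outcomeProb (p : ι → ℝ) : ∑ o, outcomeProb p o = 1 := by
  simp [Fintype.sum_option, outcomeProb]

lemma outcomeProb_nonneg (hp : ∀ j, 0 ≤ p j) (hp_sum : ∑ j, p j ≤ 1) :
    ∀ o, 0 ≤ outcomeProb p o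
  | none => sub_nonneg.2 hp_sum
  | some j => hp j

lemma sum_outcomeProb_mul_eq (hV : ∀ o, outcomeProb p o ≠ 0 → V o = c) :
    ∑ o, outcomeProb p o * V o = c := by
  calc ∑ o, outcomeProb p o * V o = ∑ o, outcomeProb p o * c :=
        sum_congr rfl fun o _ => by
          rcases eq_or_ne (outcomeProb p o) 0 with h | h
          · simp only [h, zero_mul]
          · rw [hV o h]
    _ = c := by rw [← sum_mul, sum_outcomeProb, one_mul]

lemma sum_outcomeProb_mul_le (hp : ∀ o, 0 ≤ outcomeProb p o)
    (hV : ∀ o, outcomeProb p o ≠ 0 → V o ≤ c) : ∑ o, outcomeProb p o * V o ≤ c := by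
  calc ∑ o, outcomeProb p o * V o ≤ ∑ o, outcomeProb p o * c :=
        sum_le_sum fun o _ => by
          rcases eq_or_ne (outcomeProb p o) 0 with h | h
          · simp only [h, zero_mul, le_refl]
          · exact mul_le_mul_of_nonneg_left (hV o h) (hp o)
    _ = c := sum_outcomeProb_mul_eq fun _ _ => rfl

lemma le_sum_outcomeProb_mul (hp : ∀ o, 0 ≤ outcomeProb p o)
    (hV : ∀ o, outcomeProb p o ≠ 0 → c ≤ V o) : c ≤ ∑ o, outcomeProb p o * V o := by
  have h := sum_outcomeProb_mul_le (V := fun o => -V o) hp fun o ho => neg_le_neg (hV o ho)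
  simp only [mul_neg, sum_neg_distrib] at h
  exact neg_le_neg_iff.1 h

lemma abs_sum_outcomeProb_mul_le (hp : ∀ o, 0 ≤ outcomeProb p o) (hV : ∀ o, |V o| ≤ c) :
    |∑ o, outcomeProb p o * V o| ≤ c :=
  abs_le.2 ⟨le_sum_outcomeProb_mul hp fun o _ => (abs_le.1 (hV o)).1,
    sum_outcomeProb_mul_le hp fun o _ => (abs_le.1 (hV o)).2⟩

lemma measurable_sum_outcomeProb_mul {Ω : Type*} [MeasurableSpace Ω] {P : Ω → ι → ℝ}
    {U : Option ι → Ω → ℝ} (hP : ∀ j, Measurable fun ω => P ω j) (hU : ∀ o, Measurable (U o)) :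
    Measurable fun ω => ∑ o, outcomeProb (P ω) o * U o ω := by
  refine Finset.measurable_fun_sum _ fun o _ => Measurable.mul ?_ (hU o)
  cases o with
  | none => exact measurable_const.sub (Finset.measurable_fun_sum _ fun j _ => hP j)
  | some j => exact hP j

end Outcomes

lemma measurable_fold_max {ι α : Type*} [LinearOrder α] [TopologicalSpace α]
    [OrderClosedTopology α] [SecondCountableTopology α] [MeasurableSpace α] [BorelSpace α]
    (r : α) (S : Finset ι) : Measurable fun x : ι → α => S.fold max r x := by
  classical
  induction S using Finset.induction_on with
  | empty => simp only [fold_empty, measurable_const]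
  | insert a S ha ih => simpa only [fold_insert ha] using (measurable_pi_apply a).max ih

section ResidualPrice

variable {ι : Type*} [Fintype ι] [DecidableEq ι] {r c : ℝ} {i j : ι} {o : Option ι} {x : ι → ℝ}

/-- The rivals whom buyer `i` meets in the second auction when `o` received the first unit. -/
def activeRivals (i : ι) (o : Option ι) : Finset ι :=
  univ.filter fun j => j ≠ i ∧ o ≠ some j

lemma activeRivals_none (i : ι) : activeRivals i none = univ.erase i := by
  ext j; simp [activeRivals]

lemma activeRivals_some (i j : ι) : activeRivals i (some j) = (univ.erase i).erase j := by
  ext k; simp [activeRivals, and_comm, eq_comm]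

/-- The price at which buyer `i` can still buy a unit, outside the first seller's mechanism, when
`o` received the first unit.  It is `0` if he received it himself, so that his gross payoff is
`max (v - residualPrice r i o x) 0` in every outcome `o`. -/
def residualPrice (r : ℝ) (i : ι) (o : Option ι) (x : ι → ℝ) : ℝ :=
  if o = some i then 0 else (activeRivals i o).fold max r x

lemma residualPrice_self (r : ℝ) (i : ι) (x : ι → ℝ) : residualPrice r i (some i) x = 0 :=
  if_pos rfl

lemma residualPrice_le_iff (ho : o ≠ some i) :
    residualPrice r i o x ≤ c ↔ r ≤ c ∧ ∀ j, j ≠ i → o ≠ some j → x j ≤ c := by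
  simp [residualPrice, ho, fold_max_le, activeRivals]

lemma reserve_le_residualPrice (ho : o ≠ some i) : r ≤ residualPrice r i o x :=
  ((residualPrice_le_iff ho).1 le_rfl).1

lemma le_residualPrice (ho : o ≠ some i) (hj : j ≠ i) (hoj : o ≠ some j) :
    x j ≤ residualPrice r i o x :=
  ((residualPrice_le_iff ho).1 le_rfl).2 j hj hoj

lemma residualPrice_swap (r : ℝ) (h : i ≠ j) (x : ι → ℝ) :
    residualPrice r i (some j) x = residualPrice r j (some i) x := by
  refine eq_of_forall_ge_iff fun c => ?_
  rw [residualPrice_le_iff (by simpa using h.symm), residualPrice_le_iff (by simpa using h)]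
  refine and_congr_right fun _ => forall_congr' fun k => ?_
  simp only [ne_eq, Option.some.injEq, eq_comm (a := k)]
  tauto

lemma residualPrice_update (r : ℝ) (i : ι) (o : Option ι) (x : ι → ℝ) (q : ℝ) :
    residualPrice r i o (Function.update x i q) = residualPrice r i o x := by
  unfold residualPrice
  congr 1
  exact fold_congr fun j hj => Function.update_of_ne (mem_filter.1 hj).2.1 _ _

lemma residualPrice_nonneg (hr : 0 ≤ r) (i : ι) (o : Option ι) (x : ι → ℝ) :
    0 ≤ residualPrice r i o x := by
  by_cases ho : o = some i
  · simp only [residualPrice, ho, if_true, le_refl]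
  · exact hr.trans (reserve_le_residualPrice ho)

lemma measurable_residualPrice (r : ℝ) (i : ι) (o : Option ι) :
    Measurable (residualPrice r i o) := by
  unfold residualPrice
  split_ifs
  · exact measurable_const
  · exact measurable_fold_max r _

end ResidualPrice

section GrossPayoff

variable {N : ℕ} {r v v' : ℝ} {P : (Fin N → ℝ) → Fin N → ℝ} {i : Fin N} {x : Fin N → ℝ}

lemma secondPriceSurplus_eq (r v : ℝ) (i : Fin N) (x : Fin N → ℝ) :
    secondPriceSurplus r v (univ.erase i) x = max (v - residualPrice r i none x) 0 := by
  simp [secondPriceSurplus, residualPrice, activeRivals_none]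

lemma grossPayoff_eq_sum (hv : 0 ≤ v) :
    grossPayoff r P i v x = ∑ o, outcomeProb (P x) o * max (v - residualPrice r i o x) 0 := by
  have hrivals : ∑ j ∈ univ.erase i,
      P x j * secondPriceSurplus r v ((univ.erase i).erase j) x =
      ∑ j ∈ univ.erase i, P x j * max (v - residualPrice r i (some j) x) 0 :=
    sum_congr rfl fun j hj => by
      simp [secondPriceSurplus, residualPrice, activeRivals_some, (mem_erase.1 hj).1]
  rw [grossPayoff, hrivals, secondPriceSurplus_eq, Fintype.sum_option,
    ← add_sum_erase univ (fun j => outcomeProb (P x) (some j) * _) (mem_univ i)]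
  simp only [outcomeProb, residualPrice_self, sub_zero, max_eq_left hv]
  ring

/-- The probability that buyer `i` of value `v` ends up with one of the two units. -/
def winProb (r : ℝ) (P : (Fin N → ℝ) → Fin N → ℝ) (i : Fin N) (v : ℝ) (x : Fin N → ℝ) : ℝ :=
  ∑ o, outcomeProb (P x) o * if residualPrice r i o x ≤ v then 1 else 0

lemma grossPayoff_add_winProb_mul_le (hp : ∀ o, 0 ≤ outcomeProb (P x) o) (hv : 0 ≤ v)
    (hv' : 0 ≤ v') :
    grossPayoff r P i v x + winProb r P i v x * (v' - v) ≤ grossPayoff r P i v' x := by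
  rw [grossPayoff_eq_sum hv, grossPayoff_eq_sum hv', winProb, sum_mul, ← sum_add_distrib]
  refine sum_le_sum fun o _ => ?_
  rw [mul_assoc, ← mul_add]
  refine mul_le_mul_of_nonneg_left ?_ (hp o)
  split_ifs with h
  · rw [max_eq_left (sub_nonneg.2 h)]
    exact le_max_of_le_left (by linarith)
  · rw [max_eq_right (by linarith)]
    exact le_max_of_le_right (by linarith)

lemma abs_grossPayoff_le (hp : ∀ o, 0 ≤ outcomeProb (P x) o) (hr : 0 ≤ r) (hv : 0 ≤ v) :
    |grossPayoff r P i v x| ≤ v := by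
  rw [grossPayoff_eq_sum hv]
  refine abs_sum_outcomeProb_mul_le hp fun o => ?_
  rw [abs_of_nonneg (le_max_right _ _)]
  exact max_le (sub_le_self v (residualPrice_nonneg hr i o x)) hv

lemma abs_winProb_le_one (hp : ∀ o, 0 ≤ outcomeProb (P x) o) : |winProb r P i v x| ≤ 1 :=
  abs_sum_outcomeProb_mul_le hp fun o => by split_ifs <;> norm_num

end GrossPayoff

section OrderStat

variable {N k : ℕ} {x : Fin N → ℝ} {c : ℝ}

lemma exists_isGreatest_orderStat (hk : 1 ≤ k) (hkN : k ≤ N) (x : Fin N → ℝ) :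
    ∃ i, IsGreatest {v : ℝ | k ≤ #{j | v ≤ x j}} (x i) := by
  have : Nonempty (Fin N) := ⟨⟨0, by lia⟩⟩
  obtain ⟨l, hl⟩ := Finite.exists_min x
  have hmem : l ∈ ({i | k ≤ #{j | x i ≤ x j}} : Finset (Fin N)) := by simpa [hl] using hkN
  obtain ⟨i, hi, hmax⟩ := exists_max_image _ x ⟨l, hmem⟩
  refine ⟨i, (mem_filter.1 hi).2, fun v hv => ?_⟩
  obtain ⟨j, hj, hmin⟩ := exists_min_image _ x (card_pos.1 (hk.trans hv))
  refine (mem_filter.1 hj).2.trans (hmax j (mem_filter.2 ⟨mem_univ j, hv.trans ?_⟩))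
  exact card_le_card fun m hm => mem_filter.2 ⟨mem_univ m, hmin m hm⟩

lemma exists_eq_orderStat (hk : 1 ≤ k) (hkN : k ≤ N) (x : Fin N → ℝ) :
    ∃ i, x i = orderStat k x :=
  (exists_isGreatest_orderStat hk hkN x).imp fun _ hi => hi.csSup_eq.symm

lemma le_orderStat_iff (hk : 1 ≤ k) (hkN : k ≤ N) :
    c ≤ orderStat k x ↔ k ≤ #{i | c ≤ x i} := by
  obtain ⟨i, hi⟩ := exists_isGreatest_orderStat hk hkN x
  rw [orderStat, hi.csSup_eq]
  refine ⟨fun h => ?_, fun h => hi.2 h⟩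
  exact le_trans hi.1 (card_le_card (monotone_filter_right _ fun _ _ => h.trans))

lemma orderStat_of_lt (hk : N < k) (x : Fin N → ℝ) : orderStat k x = 0 := by
  have hempty : {v : ℝ | k ≤ #{i | v ≤ x i}} = ∅ :=
    Set.eq_empty_of_forall_notMem fun v hv =>
      (card_finset_fin_le _).not_gt (hk.trans_le hv)
  rw [orderStat, hempty, Real.sSup_empty]

lemma measurable_orderStat (hk : 1 ≤ k) : Measurable (orderStat (N := N) k) := by
  rcases lt_or_ge N k with h | h
  · exact measurable_const' fun x y => by rw [orderStat_of_lt h, orderStat_of_lt h]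
  refine measurable_of_Ici fun c => ?_
  have hpre : orderStat (N := N) k ⁻¹' Set.Ici c =
      {x | (k : ℝ) ≤ ∑ i, if c ≤ x i then (1 : ℝ) else 0} := by
    ext x
    simp only [Set.mem_preimage, Set.mem_Ici, Set.mem_ofPred_eq, le_orderStat_iff hk h, sum_boole,
      Nat.cast_le]
  rw [hpre]
  refine measurableSet_le measurable_const (Finset.measurable_fun_sum _ fun i _ => ?_)
  exact Measurable.ite (measurableSet_le measurable_const (measurable_pi_apply i))
    measurable_const measurable_const

lemma orderStat_eq (hle : k ≤ #{i | c ≤ x i}) (hlt : #{i | c < x i} < k) :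
    orderStat k x = c := by
  refine IsGreatest.csSup_eq ⟨hle, fun v hv => ?_⟩
  by_contra! hcv
  exact (hlt.trans_le hv).not_ge
    (card_le_card (monotone_filter_right _ fun _ _ => hcv.trans_le))

lemma rankShare_nonneg (k : ℕ) (x : Fin N → ℝ) (i : Fin N) : 0 ≤ rankShare k x i := by
  unfold rankShare; split_ifs <;> positivity

lemma sum_rankShare (hk : 1 ≤ k) (hkN : k ≤ N) (x : Fin N → ℝ) : ∑ i, rankShare k x i = 1 := by
  obtain ⟨i, hi⟩ := exists_eq_orderStat hk hkN x
  have hcard : (#{j | x j = orderStat k x} : ℝ) ≠ 0 :=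
    Nat.cast_ne_zero.2 (card_ne_zero_of_mem (mem_filter.2 ⟨mem_univ i, hi⟩))
  unfold rankShare
  rw [← sum_filter, sum_const, nsmul_eq_mul, mul_one_div_cancel hcard]

lemma measurable_rankShare (hk : 1 ≤ k) (i : Fin N) :
    Measurable fun x : Fin N → ℝ => rankShare k x i := by
  have hset : ∀ j, MeasurableSet {x : Fin N → ℝ | x j = orderStat k x} := fun j =>
    measurableSet_eq_fun (measurable_pi_apply j) (measurable_orderStat hk)
  unfold rankShare
  simp_rw [← sum_boole]
  refine Measurable.ite (hset i) (measurable_const.div ?_) measurable_const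
  exact Finset.measurable_fun_sum _ fun j _ =>
    Measurable.ite (hset j) measurable_const measurable_const

end OrderStat

/-- Buyers `a` and `b` have the unique highest and the unique second-highest entry of `x`; this
holds almost surely, and then no tie has to be broken. -/
structure IsTopTwo {ι : Type*} (x : ι → ℝ) (a b : ι) : Prop where
  lt : x b < x a
  lt_of_ne : ∀ i, i ≠ a → i ≠ b → x i < x b

namespace IsTopTwo

variable {ι : Type*} {N : ℕ} {x : ι → ℝ} {y : Fin N → ℝ} {a b : ι} {c d : Fin N}

lemma ne (h : IsTopTwo x a b) : b ≠ a := fun hba => (hba ▸ h.lt).false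

lemma lt_fst (h : IsTopTwo x a b) {i : ι} (hi : i ≠ a) : x i < x a := by
  rcases eq_or_ne i b with rfl | hb
  · exact h.lt
  · exact (h.lt_of_ne i hi hb).trans h.lt

lemma le_fst (h : IsTopTwo x a b) (i : ι) : x i ≤ x a := by
  rcases eq_or_ne i a with rfl | hi
  · exact le_rfl
  · exact (h.lt_fst hi).le

lemma le_snd (h : IsTopTwo x a b) {i : ι} (hi : i ≠ a) : x i ≤ x b := by
  rcases eq_or_ne i b with rfl | hb
  · exact le_rfl
  · exact (h.lt_of_ne i hi hb).le

lemma two_le (h : IsTopTwo y c d) : 2 ≤ N := by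
  simpa [card_pair h.ne] using card_finset_fin_le {d, c}

lemma orderStat_one (h : IsTopTwo y c d) : orderStat 1 y = y c := by
  refine orderStat_eq (card_pos.2 ⟨c, by simp⟩) ?_
  rw [Nat.lt_one_iff, card_eq_zero, filter_eq_empty_iff]
  exact fun i _ => (h.le_fst i).not_gt

lemma orderStat_two (h : IsTopTwo y c d) : orderStat 2 y = y d := by
  refine orderStat_eq ?_ ?_
  · rw [← card_pair h.ne]
    exact card_le_card (by simp [insert_subset_iff, h.lt.le])
  · refine (card_le_card (t := {c}) fun i hi => ?_).trans_lt (by simp)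
    by_contra hic
    exact (h.le_snd (by simpa using hic)).not_gt (mem_filter.1 hi).2

lemma rankShare_one (h : IsTopTwo y c d) (i : Fin N) :
    rankShare 1 y i = if i = c then 1 else 0 := by
  have heq : ∀ j, y j = y c ↔ j = c := fun j =>
    ⟨fun hj => by_contra fun hjc => (h.lt_fst hjc).ne hj, fun hj => by rw [hj]⟩
  simp [rankShare, h.orderStat_one, heq, filter_eq']

lemma rankShare_two (h : IsTopTwo y c d) (i : Fin N) :
    rankShare 2 y i = if i = d then 1 else 0 := by
  have heq : ∀ j, y j = y d ↔ j = d := by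
    refine fun j => ⟨fun hj => by_contra fun hjd => ?_, fun hj => by rw [hj]⟩
    rcases eq_or_ne j c with rfl | hjc
    · exact h.lt.ne' hj
    · exact (h.lt_of_ne j hjc hjd).ne hj
  simp [rankShare, h.orderStat_two, heq, filter_eq']

lemma orderStat_three_eq (h : IsTopTwo y c d) {e : Fin N} (hec : e ≠ c) (hed : e ≠ d)
    (hmax : ∀ i, i ≠ c → i ≠ d → y i ≤ y e) : orderStat 3 y = y e := by
  refine orderStat_eq ?_ ?_
  · rw [← card_eq_three.2 ⟨c, d, e, h.ne.symm, hec.symm, hed.symm, rfl⟩]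
    exact card_le_card (by simp [insert_subset_iff, (h.lt_fst hec).le, h.le_snd hec])
  · refine (card_le_card (t := {c, d}) fun i hi => ?_).trans_lt (card_le_two.trans_lt (by simp))
    by_contra hcd
    simp only [mem_insert, mem_singleton, not_or] at hcd
    exact (hmax i hcd.1 hcd.2).not_gt (mem_filter.1 hi).2

-- With only two bidders `orderStat 3 y` is the junk value `0`, which `r` absorbs.
lemma max_orderStat_three (h : IsTopTwo y c d) {r : ℝ} (hr : 0 ≤ r) :
    max r (orderStat 3 y) = residualPrice r c (some d) y := by
  refine eq_of_forall_ge_iff fun u => ?_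
  rw [max_le_iff, residualPrice_le_iff (by simpa using h.ne)]
  refine and_congr_right fun hu => ?_
  rcases ((univ.erase c).erase d).eq_empty_or_nonempty with hempty | hne
  · have hN : Fintype.card (Fin N) = 2 := by
      rw [← card_univ, ← insert_erase (mem_univ c), ← insert_erase (mem_erase.2 ⟨h.ne, mem_univ d⟩),
        hempty, insert_empty_eq, card_pair h.ne.symm]
    have hthree : orderStat 3 y = 0 := orderStat_of_lt (by simp_all) y
    refine iff_of_true (hthree.trans_le (hr.trans hu)) fun j hjc hjd => absurd ?_ (notMem_empty j)
    rw [← hempty]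
    exact mem_erase.2 ⟨fun hj => hjd (congrArg some hj.symm), mem_erase.2 ⟨hjc, mem_univ j⟩⟩
  · obtain ⟨e, he, hmax⟩ := exists_max_image _ y hne
    simp only [mem_erase, mem_univ, and_true] at he hmax
    rw [h.orderStat_three_eq he.2 he.1 fun i hic hid => hmax i ⟨hid, hic⟩]
    refine ⟨fun hle j hjc hjd => (hmax j ⟨?_, hjc⟩).trans hle, fun hle => hle e he.2 ?_⟩
    · exact fun hj => hjd (congrArg some hj.symm)
    · simpa using he.1.symm

end IsTopTwo

lemma exists_isTopTwo {ι : Type*} [Finite ι] [Nontrivial ι] {x : ι → ℝ}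
    (hx : Function.Injective x) : ∃ a b, IsTopTwo x a b := by
  obtain ⟨a, ha⟩ := Finite.exists_max x
  obtain ⟨b, hba, hb⟩ := Set.exists_max_image {a}ᶜ x (Set.toFinite _) (exists_ne a)
  exact ⟨a, b, (ha b).lt_of_ne (hx.ne hba), fun i hia hib => (hb i hia).lt_of_ne (hx.ne hib)⟩

section CandidateAlloc

variable {N : ℕ} {ψ : ℝ → ℝ} {r : ℝ} {w : (Fin N → ℝ) → ℝ} {y : Fin N → ℝ} {a b : Fin N}

lemma candidateAlloc_nonneg (hw : w y ∈ Set.Icc 0 1) (i : Fin N) :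
    0 ≤ candidateAlloc ψ r w y i := by
  have h₁ := rankShare_nonneg 1 y i
  have h₂ := rankShare_nonneg 2 y i
  unfold candidateAlloc
  split_ifs
  · exact h₁
  · exact add_nonneg (mul_nonneg hw.1 h₁) (mul_nonneg (sub_nonneg.2 hw.2) h₂)
  · exact le_rfl

open Classical in
lemma sum_candidateAlloc (hN : 2 ≤ N) (ψ : ℝ → ℝ) (r : ℝ) (w : (Fin N → ℝ) → ℝ)
    (y : Fin N → ℝ) :
    ∑ i, candidateAlloc ψ r w y i = if 0 ≤ ψ (orderStat 1 y) then 1 else 0 := by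
  unfold candidateAlloc
  split_ifs
  · exact sum_rankShare le_rfl (by lia) y
  · rw [sum_add_distrib, ← mul_sum, ← mul_sum, sum_rankShare le_rfl (by lia),
      sum_rankShare (by lia) hN]
    ring
  · exact sum_const_zero

lemma sum_candidateAlloc_le_one (hN : 2 ≤ N) : ∑ i, candidateAlloc ψ r w y i ≤ 1 := by
  rw [sum_candidateAlloc hN]
  split_ifs <;> norm_num

lemma outcomeProb_candidateAlloc_nonneg (hN : 2 ≤ N) (hw : w y ∈ Set.Icc 0 1) :
    ∀ o, 0 ≤ outcomeProb (candidateAlloc ψ r w y) o :=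
  outcomeProb_nonneg (candidateAlloc_nonneg hw) (sum_candidateAlloc_le_one hN)

lemma candidate_outcome (h : IsTopTwo y a b) {o : Option (Fin N)}
    (ho : outcomeProb (candidateAlloc ψ r w y) o ≠ 0) :
    ψ (y a) < 0 ∧ o = none ∨ 0 ≤ ψ (y a) ∧ (o = some a ∨ r ≤ y b ∧ o = some b) := by
  cases o with
  | none =>
    rw [outcomeProb, sum_candidateAlloc h.two_le, h.orderStat_one] at ho
    grind
  | some i =>
    rw [outcomeProb, candidateAlloc, h.orderStat_one, h.orderStat_two, h.rankShare_one,
      h.rankShare_two] at ho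
    grind

end CandidateAlloc

section TotalSurplus

variable {ι : Type*} [Fintype ι] [DecidableEq ι] {ψ : ℝ → ℝ} {r : ℝ} {x : ι → ℝ} {i j c a b : ι}
  {o : Option ι}

/-- Contribution of buyer `i` to the virtual surplus in the outcome `o`: a buyer who ends up with a
unit counts with his virtual value, less the price that goes to the second seller. -/
def buyerSurplus (ψ : ℝ → ℝ) (r : ℝ) (i : ι) (o : Option ι) (x : ι → ℝ) : ℝ :=
  if residualPrice r i o x ≤ x i then ψ (x i) - residualPrice r i o x else 0

/-- The virtual surplus that the first seller maximizes, in the outcome `o`. -/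
def totalSurplus (ψ : ℝ → ℝ) (r : ℝ) (o : Option ι) (x : ι → ℝ) : ℝ :=
  ∑ i, buyerSurplus ψ r i o x

lemma buyerSurplus_self (hi : 0 ≤ x i) : buyerSurplus ψ r i (some i) x = ψ (x i) := by
  rw [buyerSurplus, residualPrice_self, if_pos hi, sub_zero]

lemma buyerSurplus_of_lt (hci : c ≠ i) (ho : o ≠ some i) (hoc : o ≠ some c) (hlt : x i < x c) :
    buyerSurplus ψ r i o x = 0 :=
  if_neg (hlt.trans_le (le_residualPrice ho hci hoc)).not_ge

lemma buyerSurplus_of_forall_le (ho : o ≠ some c)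
    (hmax : ∀ j, j ≠ c → o ≠ some j → x j ≤ x c) :
    buyerSurplus ψ r c o x = if r ≤ x c then ψ (x c) - residualPrice r c o x else 0 := by
  simp only [buyerSurplus, residualPrice_le_iff ho, and_iff_left hmax]

lemma totalSurplus_none (hmax : ∀ i, i ≠ a → x i < x a) :
    totalSurplus ψ r none x =
      if r ≤ x a then ψ (x a) - residualPrice r a none x else 0 := by
  rw [totalSurplus, Fintype.sum_eq_single a fun i hi => buyerSurplus_of_lt hi.symm
    (Option.some_ne_none i).symm (Option.some_ne_none a).symm (hmax i hi)]
  exact buyerSurplus_of_forall_le (Option.some_ne_none a).symm fun j hj _ => (hmax j hj).le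

lemma totalSurplus_some (hj : 0 ≤ x j) (hcj : c ≠ j)
    (hmax : ∀ i, i ≠ j → i ≠ c → x i < x c) :
    totalSurplus ψ r (some j) x =
      ψ (x j) + if r ≤ x c then ψ (x c) - residualPrice r c (some j) x else 0 := by
  have hsome : ∀ {k l : ι}, k ≠ l → some k ≠ some l := fun h => by simpa using h
  rw [totalSurplus, Fintype.sum_eq_add j c hcj.symm fun i hi => buyerSurplus_of_lt hi.2.symm
    (hsome hi.1.symm) (hsome hcj.symm) (hmax i hi.1 hi.2), buyerSurplus_self hj,
    buyerSurplus_of_forall_le (hsome hcj.symm)]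
  exact fun i hic hij => (hmax i (by simpa using Ne.symm hij) hic).le

namespace IsTopTwo

lemma residualPrice_snd_le (h : IsTopTwo x a b) (hrb : r ≤ x b) :
    residualPrice r b (some a) x ≤ x b :=
  (residualPrice_le_iff (by simpa using h.ne.symm)).2
    ⟨hrb, fun j _ hj => h.le_snd (by simpa using Ne.symm hj)⟩

lemma totalSurplus_fst (h : IsTopTwo x a b) (ha : 0 ≤ x a) :
    totalSurplus ψ r (some a) x =
      ψ (x a) + if r ≤ x b then ψ (x b) - residualPrice r b (some a) x else 0 :=
  totalSurplus_some ha h.ne h.lt_of_ne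

lemma totalSurplus_of_ne (h : IsTopTwo x a b) (hj : 0 ≤ x j) (hja : j ≠ a) :
    totalSurplus ψ r (some j) x =
      ψ (x j) + if r ≤ x a then ψ (x a) - residualPrice r a (some j) x else 0 :=
  totalSurplus_some hj hja.symm fun _ _ => h.lt_fst

lemma totalSurplus_snd_eq (h : IsTopTwo x a b) (ha : 0 ≤ x a) (hb : 0 ≤ x b) (hrb : r ≤ x b) :
    totalSurplus ψ r (some b) x = totalSurplus ψ r (some a) x := by
  rw [h.totalSurplus_fst ha, h.totalSurplus_of_ne hb h.ne, if_pos hrb, if_pos (hrb.trans h.lt.le),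
    residualPrice_swap r h.ne]
  ring

lemma totalSurplus_le_none (h : IsTopTwo x a b) (hx : ∀ i, 0 ≤ x i)
    (hmono : ∀ i, ψ (x i) ≤ ψ (x a)) (hpos : r ≤ x a → 0 ≤ ψ (x a)) (hneg : ψ (x a) < 0)
    (o : Option ι) : totalSurplus ψ r o x ≤ totalSurplus ψ r none x := by
  have har : ¬ r ≤ x a := fun hra => (hpos hra).not_gt hneg
  rw [totalSurplus_none fun i => h.lt_fst, if_neg har]
  rcases o with - | j
  · rw [totalSurplus_none fun i => h.lt_fst, if_neg har]
  rcases eq_or_ne j a with rfl | hja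
  · rw [h.totalSurplus_fst (hx j), if_neg fun hrb => har (hrb.trans h.lt.le), add_zero]
    exact hneg.le
  · rw [h.totalSurplus_of_ne (hx j) hja, if_neg har, add_zero]
    exact (hmono j).trans hneg.le

lemma totalSurplus_none_le_fst (h : IsTopTwo x a b) (hr : 0 ≤ r) (ha : 0 ≤ x a)
    (hψa : 0 ≤ ψ (x a)) (hψb : r ≤ x b → 0 ≤ ψ (x b)) :
    totalSurplus ψ r none x ≤ totalSurplus ψ r (some a) x := by
  have hnone : (none : Option ι) ≠ some a := (Option.some_ne_none a).symm
  have hreserve := reserve_le_residualPrice (r := r) (x := x) hnone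
  have hrival := le_residualPrice (r := r) (x := x) hnone h.ne (Option.some_ne_none b).symm
  rw [totalSurplus_none fun i => h.lt_fst, h.totalSurplus_fst ha]
  by_cases hrb : r ≤ x b
  · have hprice := h.residualPrice_snd_le hrb
    rw [if_pos hrb, if_pos (hrb.trans h.lt.le)]
    linarith [hψb hrb]
  · rw [if_neg hrb]
    split_ifs <;> linarith

lemma totalSurplus_some_le_fst (h : IsTopTwo x a b) (hx : ∀ i, 0 ≤ x i)
    (hmono : ∀ i j, x i ≤ x j → ψ (x i) ≤ ψ (x j)) (hle : ∀ i, ψ (x i) ≤ x i) (hja : j ≠ a) :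
    totalSurplus ψ r (some j) x ≤ totalSurplus ψ r (some a) x := by
  have hsome : some j ≠ some a := by simpa using hja
  have hreserve := reserve_le_residualPrice (r := r) (x := x) hsome
  by_cases hrb : r ≤ x b
  · rcases eq_or_ne j b with rfl | hjb
    · exact (h.totalSurplus_snd_eq (hx a) (hx j) hrb).le
    have hrival := le_residualPrice (r := r) (x := x) hsome h.ne (by simpa using hjb)
    have hprice := h.residualPrice_snd_le hrb
    have hjb' := hmono j b (h.le_snd hja)
    rw [h.totalSurplus_of_ne (hx j) hja, h.totalSurplus_fst (hx a), if_pos hrb,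
      if_pos (hrb.trans h.lt.le)]
    linarith
  · have hjr : ψ (x j) ≤ r := (hle j).trans ((h.le_snd hja).trans (not_le.1 hrb).le)
    have hja' := hmono j a (h.le_fst j)
    rw [h.totalSurplus_of_ne (hx j) hja, h.totalSurplus_fst (hx a), if_neg hrb]
    split_ifs <;> linarith

lemma totalSurplus_le_fst (h : IsTopTwo x a b) (hr : 0 ≤ r) (hx : ∀ i, 0 ≤ x i)
    (hmono : ∀ i j, x i ≤ x j → ψ (x i) ≤ ψ (x j)) (hle : ∀ i, ψ (x i) ≤ x i)
    (hpos : ∀ i, r ≤ x i → 0 ≤ ψ (x i)) (hψa : 0 ≤ ψ (x a)) (o : Option ι) :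
    totalSurplus ψ r o x ≤ totalSurplus ψ r (some a) x := by
  rcases o with - | j
  · exact h.totalSurplus_none_le_fst hr (hx a) hψa (hpos b)
  rcases eq_or_ne j a with rfl | hja
  · exact le_rfl
  · exact h.totalSurplus_some_le_fst hx hmono hle hja

end IsTopTwo

lemma totalSurplus_le_of_candidate_outcome {N : ℕ} {w : (Fin N → ℝ) → ℝ} {y : Fin N → ℝ}
    {a b : Fin N} (h : IsTopTwo y a b) (hr : 0 ≤ r) (hy : ∀ i, 0 ≤ y i)
    (hmono : ∀ i j, y i ≤ y j → ψ (y i) ≤ ψ (y j)) (hle : ∀ i, ψ (y i) ≤ y i)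
    (hpos : ∀ i, r ≤ y i → 0 ≤ ψ (y i)) {o' : Option (Fin N)}
    (ho' : outcomeProb (candidateAlloc ψ r w y) o' ≠ 0) (o : Option (Fin N)) :
    totalSurplus ψ r o y ≤ totalSurplus ψ r o' y := by
  rcases candidate_outcome h ho' with ⟨hneg, rfl⟩ | ⟨hψa, rfl | ⟨hrb, rfl⟩⟩
  · exact h.totalSurplus_le_none hy (fun i => hmono i a (h.le_fst i)) (hpos a) hneg o
  · exact h.totalSurplus_le_fst hr hy hmono hle hpos hψa o
  · rw [h.totalSurplus_snd_eq (hy a) (hy b) hrb]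
    exact h.totalSurplus_le_fst hr hy hmono hle hpos hψa o

end TotalSurplus

section VirtualSurplus

variable {N : ℕ} {ψ : ℝ → ℝ} {r : ℝ} {P : (Fin N → ℝ) → Fin N → ℝ} {w : (Fin N → ℝ) → ℝ}
  {x : Fin N → ℝ} {i : Fin N}

/-- Buyer `i`'s contribution to the expected virtual surplus at the profile `x`: his gross payoff
with his value replaced by his virtual value in the event that he ends up with a unit. -/
def virtualSurplus (ψ : ℝ → ℝ) (r : ℝ) (P : (Fin N → ℝ) → Fin N → ℝ) (i : Fin N)
    (x : Fin N → ℝ) : ℝ :=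
  ∑ o, outcomeProb (P x) o * buyerSurplus ψ r i o x

lemma virtualSurplus_eq (hx : 0 ≤ x i) :
    virtualSurplus ψ r P i x =
      grossPayoff r P i (x i) x - (x i - ψ (x i)) * winProb r P i (x i) x := by
  rw [virtualSurplus, grossPayoff_eq_sum hx, winProb, mul_sum, ← sum_sub_distrib]
  refine sum_congr rfl fun o _ => ?_
  unfold buyerSurplus
  split_ifs with h
  · rw [max_eq_left (sub_nonneg.2 h)]
    ring
  · rw [max_eq_right (by linarith)]
    ring

lemma sum_virtualSurplus (ψ : ℝ → ℝ) (r : ℝ) (P : (Fin N → ℝ) → Fin N → ℝ) (x : Fin N → ℝ) :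
    ∑ i, virtualSurplus ψ r P i x = ∑ o, outcomeProb (P x) o * totalSurplus ψ r o x := by
  simp only [virtualSurplus, totalSurplus, mul_sum]
  exact sum_comm

lemma sum_virtualSurplus_le_candidate {a b : Fin N} (h : IsTopTwo x a b)
    (hP : ∀ o, 0 ≤ outcomeProb (P x) o) (hw : w x ∈ Set.Icc 0 1) (hr : 0 ≤ r)
    (hx : ∀ i, 0 ≤ x i) (hmono : ∀ i j, x i ≤ x j → ψ (x i) ≤ ψ (x j))
    (hle : ∀ i, ψ (x i) ≤ x i) (hpos : ∀ i, r ≤ x i → 0 ≤ ψ (x i)) :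
    ∑ i, virtualSurplus ψ r P i x ≤ ∑ i, virtualSurplus ψ r (candidateAlloc ψ r w) i x := by
  rw [sum_virtualSurplus, sum_virtualSurplus]
  refine le_sum_outcomeProb_mul (outcomeProb_candidateAlloc_nonneg h.two_le hw) fun o' ho' => ?_
  exact sum_outcomeProb_mul_le hP fun o _ =>
    totalSurplus_le_of_candidate_outcome h hr hx hmono hle hpos ho' o

end VirtualSurplus

section StrongestRival

variable {ι : Type*} {x : ι → ℝ} {i c a b : ι}

/-- `c` has the highest entry of `x` among the rivals of buyer `i`. -/
structure IsStrongestRival (x : ι → ℝ) (i c : ι) : Prop where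
  ne : c ≠ i
  le : ∀ j, j ≠ i → x j ≤ x c

lemma exists_isStrongestRival [Finite ι] [Nontrivial ι] (x : ι → ℝ) (i : ι) :
    ∃ c, IsStrongestRival x i c :=
  let ⟨c, hci, hc⟩ := Set.exists_max_image {i}ᶜ x (Set.toFinite _) (exists_ne i)
  ⟨c, hci, hc⟩

lemma IsStrongestRival.update [DecidableEq ι] (h : IsStrongestRival x i c) (q : ℝ) :
    IsStrongestRival (Function.update x i q) i c := by
  refine ⟨h.ne, fun j hj => ?_⟩
  rw [Function.update_of_ne hj, Function.update_of_ne h.ne]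
  exact h.le j hj

lemma IsTopTwo.eq_snd (h : IsTopTwo x a b) (hc : IsStrongestRival x a c) : c = b :=
  by_contra fun hcb => (h.lt_of_ne c hc.ne hcb).not_ge (hc.le b h.ne)

lemma IsTopTwo.eq_fst (h : IsTopTwo x a b) (hia : i ≠ a) (hc : IsStrongestRival x i c) : c = a :=
  by_contra fun hca => (h.lt_fst hca).not_ge (hc.le a hia.symm)

end StrongestRival

section RivalPrice

variable {ι : Type*} [Fintype ι] [DecidableEq ι] {z r : ℝ} {x : ι → ℝ} {i c a : ι}
  {o : Option ι}

/-- The lowest price, as a function of the rivals' values only, at which buyer `i`, with strongest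
rival `c`, can obtain a unit from either seller when the first seller uses the candidate
mechanism. -/
def rivalPrice (z r : ℝ) (i c : ι) (x : ι → ℝ) : ℝ :=
  if x c < r then max z (x c) else residualPrice r i (some c) x

lemma rivalPrice_update (z r : ℝ) (hci : c ≠ i) (x : ι → ℝ) (q : ℝ) :
    rivalPrice z r i c (Function.update x i q) = rivalPrice z r i c x := by
  rw [rivalPrice, rivalPrice, Function.update_of_ne hci, residualPrice_update]

lemma le_rivalPrice (hzr : z ≤ r) (hci : c ≠ i) : z ≤ rivalPrice z r i c x := by
  unfold rivalPrice
  split_ifs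
  · exact le_max_left _ _
  · exact hzr.trans (reserve_le_residualPrice (by simpa using hci))

lemma IsStrongestRival.rivalPrice_le (h : IsStrongestRival x i c) (hrc : r ≤ x c) :
    rivalPrice z r i c x ≤ x c := by
  rw [rivalPrice, if_neg hrc.not_gt]
  exact (residualPrice_le_iff (by simpa using h.ne)).2 ⟨hrc, fun j hj _ => h.le j hj⟩

lemma IsStrongestRival.rivalPrice_le_residualPrice (h : IsStrongestRival x i c) (hzr : z ≤ r)
    (ho : o ≠ some i) : rivalPrice z r i c x ≤ residualPrice r i o x := by
  by_cases hcr : x c < r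
  · rw [rivalPrice, if_pos hcr]
    exact (max_le hzr hcr.le).trans (reserve_le_residualPrice ho)
  rcases eq_or_ne o (some c) with rfl | hoc
  · rw [rivalPrice, if_neg hcr]
  · exact (h.rivalPrice_le (not_lt.1 hcr)).trans (le_residualPrice ho h.ne hoc)

lemma rivalPrice_swap (z : ℝ) (hca : c ≠ a) (ha : r ≤ x a) (hc : r ≤ x c) :
    rivalPrice z r c a x = rivalPrice z r a c x := by
  rw [rivalPrice, rivalPrice, if_neg ha.not_gt, if_neg hc.not_gt, residualPrice_swap r hca]

end RivalPrice

section NetPayoff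

variable {N : ℕ} {ψ : ℝ → ℝ} {z r v : ℝ} {w : (Fin N → ℝ) → ℝ} {y : Fin N → ℝ} {a b c i : Fin N}
  {o : Option (Fin N)}

lemma rivalPrice_of_wins (h : IsTopTwo y a b) (hc : IsStrongestRival y i c)
    (hψa : 0 ≤ ψ (y a) ↔ z ≤ y a)
    (hi : outcomeProb (candidateAlloc ψ r w y) (some i) ≠ 0) :
    rivalPrice z r a b y = rivalPrice z r i c y ∧ rivalPrice z r i c y ≤ y i := by
  rcases candidate_outcome h hi with ⟨-, hnone⟩ | ⟨hpos, hfst | ⟨hrb, hsnd⟩⟩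
  · exact absurd hnone (Option.some_ne_none i)
  · obtain rfl : i = a := Option.some_inj.1 hfst
    obtain rfl := h.eq_snd hc
    refine ⟨rfl, ?_⟩
    by_cases hcr : y c < r
    · rw [rivalPrice, if_pos hcr]
      exact max_le (hψa.1 hpos) h.lt.le
    · exact (hc.rivalPrice_le (not_lt.1 hcr)).trans h.lt.le
  · obtain rfl : i = b := Option.some_inj.1 hsnd
    obtain rfl := h.eq_fst h.ne hc
    have hswap := rivalPrice_swap z h.ne (hrb.trans h.lt.le) hrb
    refine ⟨hswap.symm, ?_⟩
    rw [hswap, rivalPrice, if_neg hrb.not_gt, ← residualPrice_swap r h.ne]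
    exact h.residualPrice_snd_le hrb

lemma rivalPrice_of_loses (h : IsTopTwo y a b) (hc : IsStrongestRival y i c) (hzr : z ≤ r)
    (hψa : 0 ≤ ψ (y a) ↔ z ≤ y a) (ho : outcomeProb (candidateAlloc ψ r w y) o ≠ 0)
    (hoi : o ≠ some i) :
    y i ≤ rivalPrice z r i c y ∨ residualPrice r i o y = rivalPrice z r i c y := by
  rcases candidate_outcome h ho with ⟨hneg, -⟩ | ⟨-, rfl | ⟨hrb, rfl⟩⟩
  · have haz : y a < z := not_le.1 fun hz => (hψa.2 hz).not_gt hneg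
    exact .inl ((h.le_fst i).trans (haz.le.trans (le_rivalPrice hzr hc.ne)))
  · obtain rfl := h.eq_fst (fun hia => hoi (congrArg some hia.symm)) hc
    unfold rivalPrice
    split_ifs
    · exact .inl ((h.le_fst i).trans (le_max_right _ _))
    · exact .inr rfl
  · rcases eq_or_ne i a with rfl | hia
    · obtain rfl := h.eq_snd hc
      exact .inr (if_neg hrb.not_gt).symm
    · obtain rfl := h.eq_fst hia hc
      have hib : b ≠ i := by simpa using hoi
      rw [rivalPrice, if_neg (hrb.trans h.lt.le).not_gt]
      exact .inl ((h.le_snd hia).trans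
        (le_residualPrice (by simpa using hia.symm) hib (by simpa using h.ne.symm)))

/-- The payoff of buyer `i` of value `v` at the profile `y` of reports, net of his payment to the
first seller. -/
def netPayoff (r : ℝ) (M : DirectMechanism N) (i : Fin N) (v : ℝ) (y : Fin N → ℝ) : ℝ :=
  grossPayoff r M.alloc i v y - M.pay y i

lemma candidate_alloc (ψ : ℝ → ℝ) (z r : ℝ) (w : (Fin N → ℝ) → ℝ) :
    (candidate ψ z r w).alloc = candidateAlloc ψ r w :=
  rfl

lemma candidate_pay (h : IsTopTwo y a b) (hr : 0 ≤ r) (i : Fin N) :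
    (candidate ψ z r w).pay y i = candidateAlloc ψ r w y i * rivalPrice z r a b y := by
  simp only [candidate, rivalPrice, h.orderStat_two, h.max_orderStat_three hr]

lemma netPayoff_candidate_eq_sum (h : IsTopTwo y a b) (hr : 0 ≤ r) (hv : 0 ≤ v) (i : Fin N) :
    netPayoff r (candidate ψ z r w) i v y =
      ∑ o, outcomeProb (candidateAlloc ψ r w y) o *
        if o = some i then v - rivalPrice z r a b y else max (v - residualPrice r i o y) 0 := by
  have hpay : (candidate ψ z r w).pay y i = ∑ o, outcomeProb (candidateAlloc ψ r w y) o *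
      if o = some i then rivalPrice z r a b y else 0 := by
    simp [candidate_pay h hr, outcomeProb]
  rw [netPayoff, grossPayoff_eq_sum hv, hpay, candidate_alloc, ← sum_sub_distrib]
  refine sum_congr rfl fun o _ => ?_
  rw [← mul_sub]
  split_ifs with ho
  · rw [ho, residualPrice_self, sub_zero, max_eq_left hv]
  · rw [sub_zero]

/-- No report secures more than the value minus the price set by the rivals: the reason why truth
telling is optimal under the candidate mechanism. -/
lemma netPayoff_candidate_le (h : IsTopTwo y a b) (hc : IsStrongestRival y i c) (hr : 0 ≤ r)
    (hzr : z ≤ r) (hψa : 0 ≤ ψ (y a) ↔ z ≤ y a) (hw : w y ∈ Set.Icc 0 1) (hv : 0 ≤ v) :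
    netPayoff r (candidate ψ z r w) i v y ≤ max (v - rivalPrice z r i c y) 0 := by
  rw [netPayoff_candidate_eq_sum h hr hv]
  refine sum_outcomeProb_mul_le (outcomeProb_candidateAlloc_nonneg h.two_le hw) fun o ho => ?_
  split_ifs with hoi
  · rw [(rivalPrice_of_wins h hc hψa (hoi ▸ ho)).1]
    exact le_max_left _ _
  · exact max_le_max_right 0 (sub_le_sub_left (hc.rivalPrice_le_residualPrice hzr hoi) v)

lemma netPayoff_candidate_self (h : IsTopTwo y a b) (hc : IsStrongestRival y i c) (hr : 0 ≤ r)
    (hzr : z ≤ r) (hψa : 0 ≤ ψ (y a) ↔ z ≤ y a) (hi : 0 ≤ y i) :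
    netPayoff r (candidate ψ z r w) i (y i) y = max (y i - rivalPrice z r i c y) 0 := by
  rw [netPayoff_candidate_eq_sum h hr hi]
  refine sum_outcomeProb_mul_eq fun o ho => ?_
  split_ifs with hoi
  · obtain ⟨heq, hle⟩ := rivalPrice_of_wins h hc hψa (hoi ▸ ho)
    rw [heq, max_eq_left (sub_nonneg.2 hle)]
  · rcases rivalPrice_of_loses h hc hzr hψa ho hoi with hle | heq
    · rw [max_eq_right (sub_nonpos.2 hle), max_eq_right]
      exact sub_nonpos.2 (hle.trans (hc.rivalPrice_le_residualPrice hzr hoi))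
    · rw [heq]

end NetPayoff

section Interim

variable {N : ℕ} {μ : Measure ℝ} [IsProbabilityMeasure μ] {A : Set ℝ} {G : (Fin N → ℝ) → ℝ}

lemma ae_update_mem (hA : ∀ᵐ t ∂μ, t ∈ A) (i : Fin N) {q : ℝ} (hq : q ∈ A) :
    ∀ᵐ x ∂(Measure.pi fun _ : Fin N => μ), ∀ j, Function.update x i q j ∈ A := by
  filter_upwards [ae_pi_forall fun _ => hA] with x hx
  exact (Function.forall_update_iff x fun _ t => t ∈ A).2 ⟨hq, fun j _ => hx j⟩

lemma integrable_comp_update_of_bound (hA : ∀ᵐ t ∂μ, t ∈ A) (hG : Measurable G) {C : ℝ}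
    (hC : ∀ x, (∀ j, x j ∈ A) → |G x| ≤ C) (i : Fin N) {q : ℝ} (hq : q ∈ A) :
    Integrable (fun x => G (Function.update x i q)) (Measure.pi fun _ : Fin N => μ) :=
  .of_bound (hG.comp measurable_update_left).aestronglyMeasurable C
    ((ae_update_mem hA i hq).mono fun _ hx => hC _ hx)

lemma integrable_interim (i : Fin N) (hG : Integrable G (Measure.pi fun _ : Fin N => μ)) :
    Integrable (fun q => interim μ i q G) μ :=
  (((measurePreserving_update (fun _ : Fin N => μ) i).integrable_comp
    hG.aestronglyMeasurable).2 hG).integral_prod_left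

lemma integral_interim (i : Fin N) (hG : Integrable G (Measure.pi fun _ : Fin N => μ)) :
    ∫ q, interim μ i q G ∂μ = ∫ x, G x ∂(Measure.pi fun _ : Fin N => μ) := by
  have hmp := measurePreserving_update (fun _ : Fin N => μ) i
  have hG' := hG.aestronglyMeasurable
  calc ∫ q, interim μ i q G ∂μ
      = ∫ p, G (Function.update p.2 i p.1) ∂(μ.prod (Measure.pi fun _ : Fin N => μ)) :=
        (integral_prod _ ((hmp.integrable_comp hG').2 hG)).symm
    _ = ∫ x, G x ∂(Measure.pi fun _ : Fin N => μ) := by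
        rw [← integral_map hmp.measurable.aemeasurable (by rwa [hmp.map_eq]), hmp.map_eq]

end Interim

section Measurability

variable {N : ℕ} {r : ℝ} {P : (Fin N → ℝ) → Fin N → ℝ} {v : (Fin N → ℝ) → ℝ}

lemma measurable_secondPriceSurplus (hv : Measurable v) (S : Finset (Fin N)) :
    Measurable fun x => secondPriceSurplus r (v x) S x :=
  (hv.sub (measurable_fold_max r S)).max measurable_const

lemma measurable_grossPayoff (hP : ∀ j, Measurable fun x => P x j) (i : Fin N)
    (hv : Measurable v) : Measurable fun x => grossPayoff r P i (v x) x :=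
  (((hP i).mul hv).add (Finset.measurable_fun_sum _ fun j _ =>
    (hP j).mul (measurable_secondPriceSurplus hv _))).add
    ((measurable_const.sub (Finset.measurable_fun_sum _ fun j _ => hP j)).mul
      (measurable_secondPriceSurplus hv _))

lemma measurable_winProb (hP : ∀ j, Measurable fun x => P x j) (i : Fin N) (hv : Measurable v) :
    Measurable fun x => winProb r P i (v x) x :=
  measurable_sum_outcomeProb_mul hP fun o =>
    Measurable.ite (measurableSet_le (measurable_residualPrice r i o) hv) measurable_const
      measurable_const

end Measurability

section Envelope

variable {N : ℕ} {μ : Measure ℝ} {lo hi r q v : ℝ} {M : DirectMechanism N}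

/-- The interim expected payoff of buyer `i` of value `v` who reports `q`. -/
def interimPayoff (μ : Measure ℝ) (r : ℝ) (M : DirectMechanism N) (i : Fin N) (q v : ℝ) : ℝ :=
  interimGross μ r M i q v - interimPay μ M i q

/-- The interim probability that buyer `i` of value `q`, reporting truthfully, obtains a unit from
one of the two sellers. -/
def interimWinProb (μ : Measure ℝ) (r : ℝ) (M : DirectMechanism N) (i : Fin N) (q : ℝ) : ℝ :=
  interim μ i q fun x => winProb r M.alloc i (x i) x

lemma IsMechanism.outcomeProb_nonneg (hM : IsMechanism μ lo hi M) {x : Fin N → ℝ}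
    (hx : ∀ j, x j ∈ Set.Icc lo hi) : ∀ o, 0 ≤ outcomeProb (M.alloc x) o :=
  SequentialAuction.outcomeProb_nonneg (hM.alloc_nonneg x hx) (hM.sum_alloc_le x hx)

variable [IsProbabilityMeasure μ]

lemma integrable_grossPayoff_update (hr : 0 ≤ r) (hbox : ∀ᵐ t ∂μ, t ∈ Set.Icc lo hi)
    (hM : IsMechanism μ lo hi M) (i : Fin N) (hq : q ∈ Set.Icc lo hi) (hv : 0 ≤ v) :
    Integrable (fun x => grossPayoff r M.alloc i v (Function.update x i q))
      (Measure.pi fun _ : Fin N => μ) :=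
  integrable_comp_update_of_bound hbox
    (measurable_grossPayoff hM.measurable_alloc i measurable_const)
    (fun _ hx => abs_grossPayoff_le (hM.outcomeProb_nonneg hx) hr hv) i hq

lemma integrable_winProb_update (hbox : ∀ᵐ t ∂μ, t ∈ Set.Icc lo hi)
    (hM : IsMechanism μ lo hi M) (i : Fin N) (hq : q ∈ Set.Icc lo hi) :
    Integrable (fun x => winProb r M.alloc i v (Function.update x i q))
      (Measure.pi fun _ : Fin N => μ) :=
  integrable_comp_update_of_bound hbox
    (measurable_winProb hM.measurable_alloc i measurable_const)
    (fun _ hx => abs_winProb_le_one (hM.outcomeProb_nonneg hx)) i hq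

lemma interimGross_add_interimWinProb_mul_le (hlo : 0 ≤ lo) (hr : 0 ≤ r)
    (hbox : ∀ᵐ t ∂μ, t ∈ Set.Icc lo hi) (hM : IsMechanism μ lo hi M) (i : Fin N)
    (hq : q ∈ Set.Icc lo hi) (hv : 0 ≤ v) :
    interimGross μ r M i q q + interimWinProb μ r M i q * (v - q) ≤
      interimGross μ r M i q v := by
  have hq0 := hlo.trans hq.1
  have hgross := integrable_grossPayoff_update hr hbox hM i hq hq0
  have hwin := (integrable_winProb_update (r := r) (v := q) hbox hM i hq).mul_const (v - q)
  simp only [interimGross, interimWinProb, interim, Function.update_self]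
  rw [← integral_mul_const, ← integral_add hgross hwin]
  refine integral_mono_ae (hgross.add hwin) (integrable_grossPayoff_update hr hbox hM i hq hv) ?_
  filter_upwards [ae_update_mem hbox i hq] with x hx
  exact grossPayoff_add_winProb_mul_le (hM.outcomeProb_nonneg hx) hq0 hv

lemma isSubgradientOn_interimPayoff (hlo : 0 ≤ lo) (hr : 0 ≤ r)
    (hbox : ∀ᵐ t ∂μ, t ∈ Set.Icc lo hi) (hM : IsMechanism μ lo hi M)
    (hIC : IncentiveCompatible μ lo hi r M) (i : Fin N) :
    IsSubgradientOn (interimWinProb μ r M i) (fun v => interimPayoff μ r M i v v)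
      (Set.Icc lo hi) := fun q hq v hv => by
  have hdeviation : interimPayoff μ r M i q v ≤ interimPayoff μ r M i v v := hIC i v hv q hq
  have hconvex := interimGross_add_interimWinProb_mul_le hlo hr hbox hM i hq (hlo.trans hv.1)
  simp only [interimPayoff] at hdeviation ⊢
  linarith

lemma interimPayoff_eq_add_integral (hlo : 0 ≤ lo) (hr : 0 ≤ r)
    (hbox : ∀ᵐ t ∂μ, t ∈ Set.Icc lo hi) (hM : IsMechanism μ lo hi M)
    (hIC : IncentiveCompatible μ lo hi r M) (i : Fin N) (hq : q ∈ Set.Icc lo hi) :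
    interimPayoff μ r M i q q =
      interimPayoff μ r M i lo lo + ∫ s in lo..q, interimWinProb μ r M i s := by
  have hsub := (isSubgradientOn_interimPayoff hlo hr hbox hM hIC i).mono
    (Set.Icc_subset_Icc_right hq.2)
  rw [hsub.integral_eq_sub hq.1, add_sub_cancel]

end Envelope

section Revenue

variable {N : ℕ} {μ : Measure ℝ} [IsProbabilityMeasure μ] {lo hi r : ℝ} {f : ℝ → ℝ}
  {M : DirectMechanism N}

lemma integrable_grossPayoff_self (hlo : 0 ≤ lo) (hr : 0 ≤ r)
    (hbox : ∀ᵐ t ∂μ, t ∈ Set.Icc lo hi) (hM : IsMechanism μ lo hi M) (i : Fin N) :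
    Integrable (fun x => grossPayoff r M.alloc i (x i) x) (Measure.pi fun _ : Fin N => μ) :=
  .of_bound (measurable_grossPayoff hM.measurable_alloc i
      (measurable_pi_apply i)).aestronglyMeasurable hi
    ((ae_pi_forall fun _ => hbox).mono fun _ hx =>
      (abs_grossPayoff_le (hM.outcomeProb_nonneg hx) hr (hlo.trans (hx i).1)).trans (hx i).2)

lemma integrable_inverseHazard_mul_winProb (hd : IsDensityOn μ f lo hi)
    (hM : IsMechanism μ lo hi M) (r : ℝ) (i : Fin N) :
    Integrable (fun x => inverseHazard μ f (x i) * winProb r M.alloc i (x i) x)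
      (Measure.pi fun _ : Fin N => μ) :=
  (integrable_comp_eval (μ := fun _ : Fin N => μ) hd.integrable_inverseHazard).mul_bdd (c := 1)
    (measurable_winProb hM.measurable_alloc i (measurable_pi_apply i)).aestronglyMeasurable
    ((ae_pi_forall fun _ => hd.ae_mem_Icc).mono fun _ hx =>
      abs_winProb_le_one (hM.outcomeProb_nonneg hx))

lemma virtualSurplus_ae_eq (hlo : 0 ≤ lo) (hbox : ∀ᵐ t ∂μ, t ∈ Set.Icc lo hi) (f : ℝ → ℝ) (r : ℝ)
    (P : (Fin N → ℝ) → Fin N → ℝ) (i : Fin N) :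
    virtualSurplus (virtualValue μ f) r P i =ᵐ[Measure.pi fun _ : Fin N => μ]
      fun x => grossPayoff r P i (x i) x - inverseHazard μ f (x i) * winProb r P i (x i) x := by
  filter_upwards [ae_pi_forall fun _ => hbox] with x hx
  rw [virtualSurplus_eq (hlo.trans (hx i).1), sub_virtualValue]

lemma integrable_virtualSurplus (hlo : 0 ≤ lo) (hr : 0 ≤ r) (hd : IsDensityOn μ f lo hi)
    (hM : IsMechanism μ lo hi M) (i : Fin N) :
    Integrable (virtualSurplus (virtualValue μ f) r M.alloc i) (Measure.pi fun _ : Fin N => μ) :=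
  ((integrable_grossPayoff_self hlo hr hd.ae_mem_Icc hM i).sub
    (integrable_inverseHazard_mul_winProb hd hM r i)).congr
    (virtualSurplus_ae_eq hlo hd.ae_mem_Icc f r M.alloc i).symm

lemma integral_inverseHazard_mul_interimWinProb (hd : IsDensityOn μ f lo hi)
    (hM : IsMechanism μ lo hi M) (r : ℝ) (i : Fin N) :
    ∫ q, inverseHazard μ f q * interimWinProb μ r M i q ∂μ =
      ∫ x, inverseHazard μ f (x i) * winProb r M.alloc i (x i) x
        ∂(Measure.pi fun _ : Fin N => μ) := by
  rw [← integral_interim i (integrable_inverseHazard_mul_winProb hd hM r i)]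
  simp only [interimWinProb, interim, Function.update_self, integral_const_mul]

lemma integrable_interimPayoff (hlo : 0 ≤ lo) (hr : 0 ≤ r)
    (hbox : ∀ᵐ t ∂μ, t ∈ Set.Icc lo hi) (hM : IsMechanism μ lo hi M)
    (hIC : IncentiveCompatible μ lo hi r M) (i : Fin N) :
    Integrable (fun q => interimPayoff μ r M i q q) μ := by
  have hsub := isSubgradientOn_interimPayoff hlo hr hbox hM hIC i
  refine ((integrable_const (interimPayoff μ r M i lo lo)).add
    (integrable_integral_lower hbox hsub.integrableOn_Ioc)).congr (hbox.mono fun q hq => ?_)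
  exact (interimPayoff_eq_add_integral hlo hr hbox hM hIC i hq).symm

lemma integral_interimPayoff (hlo : 0 ≤ lo) (hr : 0 ≤ r) (hd : IsDensityOn μ f lo hi)
    (hM : IsMechanism μ lo hi M) (hIC : IncentiveCompatible μ lo hi r M) (i : Fin N) :
    ∫ q, interimPayoff μ r M i q q ∂μ = interimPayoff μ r M i lo lo +
      ∫ x, inverseHazard μ f (x i) * winProb r M.alloc i (x i) x
        ∂(Measure.pi fun _ : Fin N => μ) := by
  have hbox := hd.ae_mem_Icc
  have hsub := isSubgradientOn_interimPayoff hlo hr hbox hM hIC i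
  calc ∫ q, interimPayoff μ r M i q q ∂μ
      = ∫ q, (interimPayoff μ r M i lo lo + ∫ s in lo..q, interimWinProb μ r M i s) ∂μ :=
        integral_congr_ae (hbox.mono fun q hq =>
          interimPayoff_eq_add_integral hlo hr hbox hM hIC i hq)
    _ = interimPayoff μ r M i lo lo + ∫ q, (∫ s in lo..q, interimWinProb μ r M i s) ∂μ := by
        rw [integral_add (integrable_const _)
          (integrable_integral_lower hbox hsub.integrableOn_Ioc), integral_const, probReal_univ,
          one_smul]
    _ = _ := by
        rw [integral_integral_lower hbox hsub.integrableOn_Ioc, ← hd.integral_inverseHazard_mul,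
          integral_inverseHazard_mul_interimWinProb hd hM]

lemma integral_interimPay (hlo : 0 ≤ lo) (hr : 0 ≤ r) (hd : IsDensityOn μ f lo hi)
    (hM : IsMechanism μ lo hi M) (hIC : IncentiveCompatible μ lo hi r M) (i : Fin N) :
    ∫ q, interimPay μ M i q ∂μ =
      ∫ x, virtualSurplus (virtualValue μ f) r M.alloc i x ∂(Measure.pi fun _ : Fin N => μ) -
        interimPayoff μ r M i lo lo := by
  have hgross := integrable_grossPayoff_self hlo hr hd.ae_mem_Icc hM i
  have hsplit : ∀ q, interimPay μ M i q =
      interim μ i q (fun x => grossPayoff r M.alloc i (x i) x) - interimPayoff μ r M i q q :=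
    fun q => by
      simp only [interimPayoff, interimGross, interim, Function.update_self, sub_sub_cancel]
  simp only [hsplit]
  rw [integral_sub (integrable_interim i hgross)
      (integrable_interimPayoff hlo hr hd.ae_mem_Icc hM hIC i), integral_interim i hgross,
    integral_interimPayoff hlo hr hd hM hIC,
    integral_congr_ae (virtualSurplus_ae_eq hlo hd.ae_mem_Icc f r M.alloc i),
    integral_sub hgross (integrable_inverseHazard_mul_winProb hd hM r i)]
  ring

lemma revenue_eq (hlo : 0 ≤ lo) (hr : 0 ≤ r) (hd : IsDensityOn μ f lo hi)
    (hM : IsMechanism μ lo hi M) (hIC : IncentiveCompatible μ lo hi r M) :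
    revenue μ M =
      ∫ x, ∑ i, virtualSurplus (virtualValue μ f) r M.alloc i x ∂(Measure.pi fun _ : Fin N => μ) -
        ∑ i, interimPayoff μ r M i lo lo := by
  rw [integral_finsetSum _ fun i _ => integrable_virtualSurplus hlo hr hd hM i,
    ← sum_sub_distrib]
  exact sum_congr rfl fun i _ => integral_interimPay hlo hr hd hM hIC i

end Revenue

section Candidate

variable {N : ℕ} {lo hi z r q v : ℝ} {ψ : ℝ → ℝ} {w : (Fin N → ℝ) → ℝ} {x : Fin N → ℝ}

lemma measurable_candidateAlloc (hψ : Measurable ψ) (hw : Measurable w) (r : ℝ) (i : Fin N) :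
    Measurable fun x => candidateAlloc ψ r w x i := by
  have hfst := measurable_rankShare le_rfl i
  have hsnd := measurable_rankShare one_le_two i
  unfold candidateAlloc
  exact Measurable.ite
    (measurableSet_le measurable_const (hψ.comp (measurable_orderStat le_rfl)))
    (Measurable.ite (measurableSet_lt (measurable_orderStat one_le_two) measurable_const) hfst
      ((hw.mul hfst).add ((measurable_const.sub hw).mul hsnd))) measurable_const

lemma measurable_candidate_pay (hψ : Measurable ψ) (hw : Measurable w) (z r : ℝ) (i : Fin N) :
    Measurable fun x => (candidate ψ z r w).pay x i := by
  have hsnd : Measurable (orderStat (N := N) 2) := measurable_orderStat one_le_two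
  have hthird : Measurable (orderStat (N := N) 3) := measurable_orderStat (by norm_num)
  exact (measurable_candidateAlloc hψ hw r i).mul
    (Measurable.ite (measurableSet_lt hsnd measurable_const) (measurable_const.max hsnd)
      (measurable_const.max hthird))

lemma orderStat_le {k : ℕ} (hk : 1 ≤ k) (hhi : 0 ≤ hi) (hx : ∀ j, x j ≤ hi) :
    orderStat k x ≤ hi := by
  rcases lt_or_ge N k with hNk | hkN
  · rwa [orderStat_of_lt hNk]
  · obtain ⟨i, heq⟩ := exists_eq_orderStat hk hkN x
    exact heq ▸ hx i

lemma abs_candidate_pay_le (hN : 2 ≤ N) (hz : z ∈ Set.Icc 0 hi) (hr : 0 ≤ r)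
    (hw : w x ∈ Set.Icc 0 1) (hx : ∀ j, x j ≤ hi) (i : Fin N) :
    |(candidate ψ z r w).pay x i| ≤ max r hi := by
  have hhi := hz.1.trans hz.2
  have hnonneg : ∀ j, 0 ≤ candidateAlloc ψ r w x j := candidateAlloc_nonneg hw
  have hle_one : candidateAlloc ψ r w x i ≤ 1 :=
    (Finset.single_le_sum (fun j _ => hnonneg j) (Finset.mem_univ i)).trans
      (sum_candidateAlloc_le_one hN)
  have hprice : ∀ p ∈ Set.Icc 0 (max r hi), |candidateAlloc ψ r w x i * p| ≤ max r hi :=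
    fun p hp => by
      rw [abs_of_nonneg (mul_nonneg (hnonneg i) hp.1)]
      exact (mul_le_of_le_one_left hp.1 hle_one).trans hp.2
  refine hprice _ ?_
  split_ifs
  · exact ⟨le_max_of_le_left hz.1,
      le_max_of_le_right (max_le hz.2 (orderStat_le one_le_two hhi hx))⟩
  · exact ⟨le_max_of_le_left hr, max_le_max_left r (orderStat_le (by norm_num) hhi hx)⟩

variable {μ : Measure ℝ} [IsProbabilityMeasure μ]

lemma isMechanism_candidate (hN : 2 ≤ N) (hbox : ∀ᵐ t ∂μ, t ∈ Set.Icc lo hi)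
    (hψ : Measurable ψ) (hz : z ∈ Set.Icc 0 hi) (hr : 0 ≤ r) (hw_meas : Measurable w)
    (hw : ∀ x, w x ∈ Set.Icc (0 : ℝ) 1) : IsMechanism μ lo hi (candidate ψ z r w) where
  measurable_alloc := measurable_candidateAlloc hψ hw_meas r
  measurable_pay := measurable_candidate_pay hψ hw_meas z r
  alloc_nonneg x _ := candidateAlloc_nonneg (hw x)
  sum_alloc_le _ _ := sum_candidateAlloc_le_one hN
  integrable_pay i _ hq :=
    integrable_comp_update_of_bound hbox (measurable_candidate_pay hψ hw_meas z r i)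
      (fun x hx => abs_candidate_pay_le hN hz hr (hw x) (fun j => (hx j).2) i) i hq

lemma integrable_netPayoff_update {M : DirectMechanism N} (hr : 0 ≤ r)
    (hbox : ∀ᵐ t ∂μ, t ∈ Set.Icc lo hi) (hM : IsMechanism μ lo hi M) (i : Fin N)
    (hq : q ∈ Set.Icc lo hi) (hv : 0 ≤ v) :
    Integrable (fun x => netPayoff r M i v (Function.update x i q))
      (Measure.pi fun _ : Fin N => μ) :=
  (integrable_grossPayoff_update hr hbox hM i hq hv).sub (hM.integrable_pay i q hq)

lemma interimPayoff_eq_interim_netPayoff {M : DirectMechanism N} (hr : 0 ≤ r)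
    (hbox : ∀ᵐ t ∂μ, t ∈ Set.Icc lo hi) (hM : IsMechanism μ lo hi M) (i : Fin N)
    (hq : q ∈ Set.Icc lo hi) (hv : 0 ≤ v) :
    interimPayoff μ r M i q v = interim μ i q (netPayoff r M i v) :=
  (integral_sub (integrable_grossPayoff_update hr hbox hM i hq hv)
    (hM.integrable_pay i q hq)).symm

lemma integrable_secondPriceSurplus_update (hr : 0 ≤ r) (hv : 0 ≤ v) (i : Fin N) :
    Integrable (fun x => secondPriceSurplus r v (Finset.univ.erase i) (Function.update x i v))
      (Measure.pi fun _ : Fin N => μ) := by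
  refine integrable_comp_update_of_bound (A := Set.univ) (C := v) (.of_forall Set.mem_univ)
    (measurable_secondPriceSurplus measurable_const _) (fun x _ => ?_) i (Set.mem_univ v)
  rw [secondPriceSurplus_eq, abs_of_nonneg (le_max_right _ _)]
  exact max_le (sub_le_self v (residualPrice_nonneg hr i none x)) hv

variable [NullSingletonClass μ]

lemma ae_exists_isTopTwo_update (hN : 2 ≤ N) (hIoo : ∀ᵐ t ∂μ, t ∈ Set.Ioo lo hi) (i : Fin N)
    (hq : q ∈ Set.Icc lo hi) :
    ∀ᵐ x ∂(Measure.pi fun _ : Fin N => μ), ∃ a b, IsTopTwo (Function.update x i q) a b ∧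
      Function.update x i q a ∈ Set.Ioc lo hi := by
  have : Nontrivial (Fin N) := Fin.nontrivial_iff_two_le.2 hN
  obtain ⟨j, hj⟩ := exists_ne i
  have hbox : ∀ᵐ t ∂μ, t ∈ Set.Icc lo hi := hIoo.mono fun _ ht => Set.Ioo_subset_Icc_self ht
  filter_upwards [ae_pi_injective_update i q, ae_pi_forall fun _ => hIoo, ae_update_mem hbox i hq]
    with x hinj hx hmem
  obtain ⟨a, b, h⟩ := exists_isTopTwo hinj
  refine ⟨a, b, h, lt_of_lt_of_le ?_ (h.le_fst j), (hmem a).2⟩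
  rw [Function.update_of_ne hj]
  exact (hx j).1

lemma ae_netPayoff_candidate_le (hN : 2 ≤ N) (hIoo : ∀ᵐ t ∂μ, t ∈ Set.Ioo lo hi)
    (hψ : ∀ t ∈ Set.Ioc lo hi, 0 ≤ ψ t ↔ z ≤ t) (hr : 0 ≤ r) (hzr : z ≤ r)
    (hw : ∀ x, w x ∈ Set.Icc (0 : ℝ) 1) (i : Fin N) (hq : q ∈ Set.Icc lo hi) (hv : 0 ≤ v) :
    ∀ᵐ x ∂(Measure.pi fun _ : Fin N => μ), ∀ c, IsStrongestRival x i c →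
      netPayoff r (candidate ψ z r w) i v (Function.update x i q) ≤
        max (v - rivalPrice z r i c x) 0 := by
  filter_upwards [ae_exists_isTopTwo_update hN hIoo i hq] with x ⟨a, b, h, ha⟩ c hc
  rw [← rivalPrice_update z r hc.ne x q]
  exact netPayoff_candidate_le h (hc.update q) hr hzr (hψ _ ha) (hw _) hv

lemma ae_netPayoff_candidate_self (hN : 2 ≤ N) (hIoo : ∀ᵐ t ∂μ, t ∈ Set.Ioo lo hi)
    (hψ : ∀ t ∈ Set.Ioc lo hi, 0 ≤ ψ t ↔ z ≤ t) (hr : 0 ≤ r) (hzr : z ≤ r)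
    (w : (Fin N → ℝ) → ℝ) (i : Fin N) (hq : q ∈ Set.Icc lo hi) (hq0 : 0 ≤ q) :
    ∀ᵐ x ∂(Measure.pi fun _ : Fin N => μ), ∀ c, IsStrongestRival x i c →
      netPayoff r (candidate ψ z r w) i q (Function.update x i q) =
        max (q - rivalPrice z r i c x) 0 := by
  filter_upwards [ae_exists_isTopTwo_update hN hIoo i hq] with x ⟨a, b, h, ha⟩ c hc
  have hself := netPayoff_candidate_self (w := w) h (hc.update q) hr hzr (hψ _ ha)
  rw [Function.update_self, rivalPrice_update z r hc.ne] at hself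
  exact hself hq0

lemma incentiveCompatible_candidate (hN : 2 ≤ N) (hlo : 0 ≤ lo)
    (hIoo : ∀ᵐ t ∂μ, t ∈ Set.Ioo lo hi) (hM : IsMechanism μ lo hi (candidate ψ z r w))
    (hψ : ∀ t ∈ Set.Ioc lo hi, 0 ≤ ψ t ↔ z ≤ t) (hr : 0 ≤ r) (hzr : z ≤ r)
    (hw : ∀ x, w x ∈ Set.Icc (0 : ℝ) 1) :
    IncentiveCompatible μ lo hi r (candidate ψ z r w) := fun i v hv q hq => by
  have : Nontrivial (Fin N) := Fin.nontrivial_iff_two_le.2 hN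
  have hbox : ∀ᵐ t ∂μ, t ∈ Set.Icc lo hi := hIoo.mono fun _ ht => Set.Ioo_subset_Icc_self ht
  have hv0 := hlo.trans hv.1
  change interimPayoff μ r (candidate ψ z r w) i q v ≤ interimPayoff μ r (candidate ψ z r w) i v v
  rw [interimPayoff_eq_interim_netPayoff hr hbox hM i hq hv0,
    interimPayoff_eq_interim_netPayoff hr hbox hM i hv hv0]
  refine integral_mono_ae (integrable_netPayoff_update hr hbox hM i hq hv0)
    (integrable_netPayoff_update hr hbox hM i hv hv0) ?_
  filter_upwards [ae_netPayoff_candidate_le hN hIoo hψ hr hzr hw i hq hv0,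
    ae_netPayoff_candidate_self hN hIoo hψ hr hzr w i hv hv0] with x hdeviate htruth
  obtain ⟨c, hc⟩ := exists_isStrongestRival x i
  exact (hdeviate c hc).trans_eq (htruth c hc).symm

lemma individuallyRational_candidate (hN : 2 ≤ N) (hlo : 0 ≤ lo)
    (hIoo : ∀ᵐ t ∂μ, t ∈ Set.Ioo lo hi) (hM : IsMechanism μ lo hi (candidate ψ z r w))
    (hψ : ∀ t ∈ Set.Ioc lo hi, 0 ≤ ψ t ↔ z ≤ t) (hr : 0 ≤ r) (hzr : z ≤ r) :
    IndividuallyRational μ lo hi r (candidate ψ z r w) := fun i v hv => by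
  have : Nontrivial (Fin N) := Fin.nontrivial_iff_two_le.2 hN
  have hbox : ∀ᵐ t ∂μ, t ∈ Set.Icc lo hi := hIoo.mono fun _ ht => Set.Ioo_subset_Icc_self ht
  have hv0 := hlo.trans hv.1
  change _ ≤ interimPayoff μ r (candidate ψ z r w) i v v
  rw [interimPayoff_eq_interim_netPayoff hr hbox hM i hv hv0]
  refine integral_mono_ae (integrable_secondPriceSurplus_update hr hv0 i)
    (integrable_netPayoff_update hr hbox hM i hv hv0) ?_
  filter_upwards [ae_netPayoff_candidate_self hN hIoo hψ hr hzr w i hv hv0] with x htruth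
  obtain ⟨c, hc⟩ := exists_isStrongestRival x i
  rw [htruth c hc, secondPriceSurplus_eq, residualPrice_update]
  exact max_le_max_right 0
    (sub_le_sub_left (hc.rivalPrice_le_residualPrice hzr (Option.some_ne_none i).symm) v)

lemma interimPayoff_candidate_lowest (hN : 2 ≤ N) (hlo : 0 ≤ lo)
    (hIoo : ∀ᵐ t ∂μ, t ∈ Set.Ioo lo hi) (hM : IsMechanism μ lo hi (candidate ψ z r w))
    (hψ : ∀ t ∈ Set.Ioc lo hi, 0 ≤ ψ t ↔ z ≤ t) (hz : z ∈ Set.Icc lo hi) (hzr : z ≤ r)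
    (i : Fin N) : interimPayoff μ r (candidate ψ z r w) i lo lo = 0 := by
  have : Nontrivial (Fin N) := Fin.nontrivial_iff_two_le.2 hN
  have hbox : ∀ᵐ t ∂μ, t ∈ Set.Icc lo hi := hIoo.mono fun _ ht => Set.Ioo_subset_Icc_self ht
  have hr := (hlo.trans hz.1).trans hzr
  have hlo_mem : lo ∈ Set.Icc lo hi := ⟨le_rfl, hz.1.trans hz.2⟩
  rw [interimPayoff_eq_interim_netPayoff hr hbox hM i hlo_mem hlo]
  refine integral_eq_zero_of_ae ?_
  filter_upwards [ae_netPayoff_candidate_self hN hIoo hψ hr hzr w i hlo_mem hlo] with x htruth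
  obtain ⟨c, hc⟩ := exists_isStrongestRival x i
  rw [htruth c hc]
  exact max_eq_right (sub_nonpos.2 (hz.1.trans (le_rivalPrice hzr hc.ne)))

end Candidate

section Threshold

variable {μ : Measure ℝ} {f : ℝ → ℝ} {lo hi z t : ℝ}

lemma continuousWithinAt_virtualValue {s : Set ℝ} (hs : s ⊆ Set.Ici t)
    (hf : ContinuousWithinAt f s t) (hft : f t ≠ 0) :
    ContinuousWithinAt (virtualValue μ f) s t :=
  continuousWithinAt_id.sub ((continuousWithinAt_const.sub
    (((ProbabilityTheory.cdf μ).right_continuous t).mono hs)).div hf hft)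

lemma virtualValue_nonneg_iff (hf_cont : ContinuousOn f (Set.Ico lo hi))
    (hψ : StrictMonoOn (virtualValue μ f) (Set.Ioo lo hi)) (hz_mem : z ∈ Set.Ico lo hi)
    (hfz : f z ≠ 0) (hz : virtualValue μ f z = 0) (ht : t ∈ Set.Ioo lo hi) :
    0 ≤ virtualValue μ f t ↔ z ≤ t := by
  rcases hz_mem.1.eq_or_lt with rfl | hloz
  · refine iff_of_true ?_ ht.1.le
    have := left_nhdsWithin_Ioo_neBot ht.1
    have hlim : ContinuousWithinAt (virtualValue μ f) (Set.Ioo lo t) lo :=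
      continuousWithinAt_virtualValue (fun _ hs => hs.1.le)
        ((hf_cont lo hz_mem).mono fun s hs => ⟨hs.1.le, hs.2.trans ht.2⟩) hfz
    rw [← hz]
    refine le_of_tendsto hlim ?_
    filter_upwards [self_mem_nhdsWithin] with s hs
    exact (hψ ⟨hs.1, hs.2.trans ht.2⟩ ht hs.2).le
  · rw [← hz, hψ.le_iff_le ⟨hloz, hz_mem.2⟩ ht]

variable [IsProbabilityMeasure μ]

lemma IsDensityOn.virtualValue_right (h : IsDensityOn μ f lo hi) : virtualValue μ f hi = hi := by
  have hcdf : ProbabilityTheory.cdf μ hi = 1 := by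
    have hIic : μ (Set.Iic hi) = 1 := by
      rw [← mem_ae_iff_prob_eq_one measurableSet_Iic]
      exact h.ae_mem_Icc.mono fun _ ht => ht.2
    rw [ProbabilityTheory.cdf_eq_real, measureReal_def, hIic, ENNReal.toReal_one]
  rw [virtualValue, hcdf, sub_self, zero_div, sub_zero]

lemma IsDensityOn.virtualValue_nonneg_iff_of_mem_Ioc (h : IsDensityOn μ f lo hi) (hz0 : 0 ≤ z)
    (hzhi : z ≤ hi) (hψz : ∀ t ∈ Set.Ioo lo hi, 0 ≤ virtualValue μ f t ↔ z ≤ t)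
    (ht : t ∈ Set.Ioc lo hi) : 0 ≤ virtualValue μ f t ↔ z ≤ t := by
  rcases ht.2.eq_or_lt with rfl | hthi
  · rw [h.virtualValue_right]
    exact iff_of_true (hz0.trans hzhi) hzhi
  · exact hψz t ⟨ht.1, hthi⟩

end Threshold

section Optimality

variable {N : ℕ} {μ : Measure ℝ} {lo hi z r : ℝ} {ψ f : ℝ → ℝ} {w : (Fin N → ℝ) → ℝ}
  {M : DirectMechanism N}

lemma IndividuallyRational.interimPayoff_nonneg (hIR : IndividuallyRational μ lo hi r M)
    (hlohi : lo ≤ hi) (i : Fin N) : 0 ≤ interimPayoff μ r M i lo lo :=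
  (integral_nonneg fun _ => le_max_right _ _).trans (hIR i lo ⟨le_rfl, hlohi⟩)

variable [IsProbabilityMeasure μ]

lemma isFeasible_candidate [NullSingletonClass μ] (hN : 2 ≤ N) (hlo : 0 ≤ lo)
    (hIoo : ∀ᵐ t ∂μ, t ∈ Set.Ioo lo hi) (hψm : Measurable ψ)
    (hψ : ∀ t ∈ Set.Ioc lo hi, 0 ≤ ψ t ↔ z ≤ t) (hz : z ∈ Set.Icc lo hi) (hzr : z ≤ r)
    (hw_meas : Measurable w) (hw : ∀ x, w x ∈ Set.Icc (0 : ℝ) 1) :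
    IsFeasible μ lo hi r (candidate ψ z r w) := by
  have hz0 := hlo.trans hz.1
  have hr := hz0.trans hzr
  have hM : IsMechanism μ lo hi (candidate ψ z r w) := isMechanism_candidate hN
    (hIoo.mono fun _ ht => Set.Ioo_subset_Icc_self ht) hψm ⟨hz0, hz.2⟩ hr hw_meas hw
  exact ⟨hM, incentiveCompatible_candidate hN hlo hIoo hM hψ hr hzr hw,
    individuallyRational_candidate hN hlo hIoo hM hψ hr hzr⟩

lemma ae_sum_virtualSurplus_le_candidate (hN : 2 ≤ N) (hlo : 0 ≤ lo) (hd : IsDensityOn μ f lo hi)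
    (hψ : MonotoneOn (virtualValue μ f) (Set.Ioo lo hi))
    (hψz : ∀ t ∈ Set.Ioo lo hi, 0 ≤ virtualValue μ f t ↔ z ≤ t) (hr : 0 ≤ r) (hzr : z ≤ r)
    (hw : ∀ x, w x ∈ Set.Icc (0 : ℝ) 1) (hM : IsMechanism μ lo hi M) :
    ∀ᵐ x ∂(Measure.pi fun _ : Fin N => μ), ∑ i, virtualSurplus (virtualValue μ f) r M.alloc i x ≤
      ∑ i, virtualSurplus (virtualValue μ f) r (candidateAlloc (virtualValue μ f) r w) i x := by
  have : Nontrivial (Fin N) := Fin.nontrivial_iff_two_le.2 hN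
  have := hd.nullSingletonClass
  filter_upwards [ae_pi_injective, ae_pi_forall fun _ => hd.ae_mem_Ioo] with x hinj hx
  obtain ⟨a, b, h⟩ := exists_isTopTwo hinj
  have hbox := fun j => Set.Ioo_subset_Icc_self (hx j)
  exact sum_virtualSurplus_le_candidate h (hM.outcomeProb_nonneg hbox) (hw x) hr
    (fun i => hlo.trans (hbox i).1) (fun i j => hψ (hx i) (hx j))
    (fun i => hd.virtualValue_le (hx i)) fun i hri => (hψz _ (hx i)).2 (hzr.trans hri)

end Optimality

end SequentialAuction

end

open SequentialAuction in
theorem theorem2_general {N : ℕ} (hN : 2 ≤ N) {lo hi : ℝ} (hlo : 0 ≤ lo)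
    {μ : Measure ℝ} [IsProbabilityMeasure μ] {f : ℝ → ℝ} (hd : IsDensityOn μ f lo hi)
    (hψ : MonotoneOn (virtualValue μ f) (Set.Ioo lo hi))
    {z : ℝ} (hz : z ∈ Set.Icc lo hi)
    (hψz : ∀ t ∈ Set.Ioo lo hi, 0 ≤ virtualValue μ f t ↔ z ≤ t)
    {r : ℝ} (hzr : z ≤ r)
    {w : (Fin N → ℝ) → ℝ} (hw_meas : Measurable w) (hw : ∀ x, w x ∈ Set.Icc (0 : ℝ) 1) :
    IsOptimal μ lo hi r (candidate (virtualValue μ f) z r w) := by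
  have := hd.nullSingletonClass
  have hz0 := hlo.trans hz.1
  have hr := hz0.trans hzr
  have hψz' : ∀ t ∈ Set.Ioc lo hi, 0 ≤ virtualValue μ f t ↔ z ≤ t := fun _ =>
    hd.virtualValue_nonneg_iff_of_mem_Ioc hz0 hz.2 hψz
  have hfeas : IsFeasible μ lo hi r (candidate (virtualValue μ f) z r w) :=
    isFeasible_candidate hN hlo hd.ae_mem_Ioo (measurable_virtualValue hd.measurable) hψz' hz hzr
      hw_meas hw
  have hint {M : DirectMechanism N} (hM : IsFeasible μ lo hi r M) :=
    integrable_finsetSum Finset.univ fun i _ =>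
      integrable_virtualSurplus hlo hr hd hM.isMechanism i
  refine ⟨hfeas, fun M hM => ?_⟩
  rw [revenue_eq hlo hr hd hM.isMechanism hM.incentiveCompatible,
    revenue_eq hlo hr hd hfeas.isMechanism hfeas.incentiveCompatible]
  refine sub_le_sub (integral_mono_ae (hint hM) (hint hfeas)
    (ae_sum_virtualSurplus_le_candidate hN hlo hd hψ hψz hr hzr hw hM.isMechanism))
    (Finset.sum_le_sum fun i _ => ?_)
  rw [interimPayoff_candidate_lowest hN hlo hd.ae_mem_Ioo hfeas.isMechanism hψz' hz hzr]
  exact hM.individuallyRational.interimPayoff_nonneg (hz.1.trans hz.2) i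

theorem theorem2 (N : ℕ) (hN : 2 ≤ N)
    (lo hi : ℝ) (hlo : 0 ≤ lo) (hlohi : lo < hi)
    (μ : Measure ℝ) [IsProbabilityMeasure μ]
    (f : ℝ → ℝ)
    (hf_cont : ContinuousOn f (Set.Icc lo hi))
    (hf_pos : ∀ x ∈ Set.Ioo lo hi, 0 < f x)
    (hf_zero : ∀ x, x ∉ Set.Icc lo hi → f x = 0)
    (hμ : μ = volume.withDensity fun x => ENNReal.ofReal (f x))
    (hψ : StrictMonoOn (SequentialAuction.virtualValue μ f) (Set.Ioo lo hi))
    (z : ℝ) (hz_mem : z ∈ Set.Ico lo hi) (hz_pos : 0 < f z)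
    (hz : SequentialAuction.virtualValue μ f z = 0)
    (r : ℝ) (hr : r ∈ Set.Ico z hi)
    (w : (Fin N → ℝ) → ℝ) (hw_meas : Measurable w) (hw : ∀ x, w x ∈ Set.Icc (0 : ℝ) 1) :
    SequentialAuction.IsOptimal μ lo hi r
      (SequentialAuction.candidate (SequentialAuction.virtualValue μ f) z r w) :=
  open SequentialAuction in
  theorem2_general hN hlo
    ⟨measurable_of_continuousOn_Icc hf_cont hf_zero, hf_pos, hf_zero, hμ⟩ hψ.monotoneOn
    ⟨hz_mem.1, hz_mem.2.le⟩
    (fun _ =>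
      virtualValue_nonneg_iff (hf_cont.mono Set.Ico_subset_Icc_self) hψ hz_mem hz_pos.ne' hz)
    hr.1 hw_meas hw
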